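/- Let $G=(V,E)$ be a connected, locally finite graph with at least two vertices, with edge weights $\omega_{xy}=\omega_{yx}>0$ and a vertex measure $\mu:V\to(0,\infty)$ such that $\mu(x)\ge\mu_0$ for all $x\in V$ and some constant $\mu_0>0$. Write $\int_V\psi\,d\mu=\sum_{x\in V}\mu(x)\psi(x)$ and $$\Delta\psi(x)=\frac1{\mu(x)}\sum_{y\sim x}\omega_{xy}(\psi(y)-\psi(x)),\qquad \nabla\psi_1\cdot\nabla\psi_2(x)=\frac1{2\mu(x)}\sum_{y\sim x}\omega_{xy}(\psi_1(y)-\psi_1(x))(\psi_2(y)-\psi_2(x)),\qquad |\nabla\psi|^2=\nabla\psi\cdot\nabla\psi .$$ Let $h:V\to\mathbb R$ satisfy $h(x)\ge h_0$ for all $x\in V$ and some constant $h_0>0$, and $h(x)\to+\infty$ as $d(x,x_0)\to\infty$ for some $x_0\in V$, where $d$ is the graph distance. Let $W^{1,2}(V)$ be the completion of the finitely supported functions on $V$ under the norm $\left(\int_V(|\nabla u|^2+|u|^2)\,d\mu\right)^{1/2}$, and let $$W_h^{1,2}(V)=\Big\{u\in W^{1,2}(V):\int_V h|u|^2\,d\mu<\infty\Big\},\qquad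 \|u\|_{W_h}=\Big(\int_V(|\nabla u|^2+h|u|^2)\,d\mu\Big)^{1/2}.$$ Let $a>0$, $b\ge0$, $\lambda,\eta\in\mathbb R$, and put $$\lambda_1^*=\inf_{u\in W_h^{1,2}(V)\setminus\{0\}}\frac{\|u\|_{W_h}^2}{\int_V|u|^2\,d\mu},\qquad \eta_0^*=\inf_{u\in W_h^{1,2}(V)\setminus\{0\}}\frac{b\,\|u\|_{W_h}^4}{\int_V|u|^4\,d\mu},$$ $$J(u)=\frac a2\|u\|_{W_h}^2-\frac\lambda2\int_V|u|^2\,d\mu+\frac b4\|u\|_{W_h}^4-\frac\eta4\int_V|u|^4\,d\mu\qquad(u\in W_h^{1,2}(V)).$$ Consider the equation $$\big(a+b\|u\|_{W_h}^2\big)\big(-\Delta u+h(x)u\big)=\lambda u+\eta|u|^2u,\qquad x\in V.\tag{$*$}$$ A nontrivial solution is a function $u\in W_h^{1,2}(V)$, $u\ne0$, that satisfies $(*)$ at every $x\in V$; a least energy solution is a nontrivial solution that minimizes $J$ among all nontrivial solutions. 1. If $\lambda<a\lambda_1^*$ and $\eta\le\eta_0^*$, then $(*)$ has no nontrivial solution.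 2. If $|\lambda|<a\lambda_1^*$ and $\eta>\eta_0^*$, then $(*)$ has a least energy solution $u_b^*$, which moreover belongs to the Nehari set $\mathcal M=\{u\in W_h^{1,2}(V)\setminus\{0\}:\langle J'(u),u\rangle=0\}$ and minimizes $J$ over $\mathcal M$, and which satisfies $$\|u_b^*\|_{W_h}>\left(\frac{a-\frac{\lambda}{\lambda_1^*}}{\eta}\,\mu_0h_0^2\right)^{1/2},\qquad J(u_b^*)>\frac14\left(a-\frac{|\lambda|}{\lambda_1^*}\right)\left(\frac{a-\frac{\lambda}{\lambda_1^*}}{\eta}\,\mu_0h_0^2\right).$$ -/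

import Mathlib

/-- A connected, locally finite graph on the vertex set `V`, with symmetric positive edge weights
and a positive vertex measure. -/
structure WeightedGraph (V : Type*) where
  /-- the underlying graph; `x ∼ y` is `graph.Adj x y` -/
  graph : SimpleGraph V
  connected : graph.Connected
  locallyFinite : ∀ x, {y | graph.Adj x y}.Finite
  /-- the edge weights; only the values on edges are ever used -/
  weight : V → V → ℝ
  weight_symm : ∀ x y, graph.Adj x y → weight x y = weight y x
  weight_pos : ∀ x y, graph.Adj x y → 0 < weight x y
  /-- the measure of the single vertices -/
  μ : V → ℝ
  μ_pos : ∀ x, 0 < μ x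

namespace WeightedGraph

noncomputable section

variable {V : Type*} (G : WeightedGraph V)

/-- The finite set of neighbours of `x`. -/
def nbrs (x : V) : Finset V := (G.locallyFinite x).toFinset

/-- The graph Laplacian `Δψ(x) = μ(x)⁻¹ ∑_{y ∼ x} w_{xy} (ψ(y) - ψ(x))`. -/
def laplacian (ψ : V → ℝ) (x : V) : ℝ :=
  1 / G.μ x * ∑ y ∈ G.nbrs x, G.weight x y * (ψ y - ψ x)

/-- The gradient form
`Γ(ψ₁,ψ₂)(x) = (2μ(x))⁻¹ ∑_{y ∼ x} w_{xy} (ψ₁(y) - ψ₁(x)) (ψ₂(y) - ψ₂(x))`, also written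
`∇ψ₁ ⬝ ∇ψ₂`; in particular `|∇ψ|² = Γ(ψ,ψ)`. -/
def gradForm (ψ₁ ψ₂ : V → ℝ) (x : V) : ℝ :=
  1 / (2 * G.μ x) * ∑ y ∈ G.nbrs x, G.weight x y * (ψ₁ y - ψ₁ x) * (ψ₂ y - ψ₂ x)

/-- `ψ` is integrable over `V`, i.e. `∑ μ(x) ψ(x)` converges absolutely. -/
def IntegrableV (ψ : V → ℝ) : Prop := Summable fun x => G.μ x * ψ x

/-- `∫_V ψ dμ = ∑_{x ∈ V} μ(x) ψ(x)`. -/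
def integral (ψ : V → ℝ) : ℝ := ∑' x, G.μ x * ψ x

/-- The integrand `|∇u|² + |u|²` of the squared norm of `W^{1,2}(V)`. -/
def densityW12 (u : V → ℝ) (x : V) : ℝ := G.gradForm u u x + |u x| ^ 2

/-- `u` belongs to `W^{1,2}(V)`, the completion of the finitely supported functions under
`‖u‖ = (∫_V (|∇u|² + |u|²) dμ)^{1/2}`. Convergence in this norm implies pointwise convergence, so the
completion is realised as the space of those functions on `V` that are limits, in this norm, of
finitely supported functions. -/
def MemW12 (u : V → ℝ) : Prop :=
  ∀ ε : ℝ, 0 < ε → ∃ φ : V → ℝ, φ.support.Finite ∧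
    G.IntegrableV (G.densityW12 (u - φ)) ∧ √(G.integral (G.densityW12 (u - φ))) < ε

/-- `u ∈ W_h^{1,2}(V)`: `u ∈ W^{1,2}(V)` and `∫_V h |u|² dμ < ∞`. -/
def MemWh (h u : V → ℝ) : Prop :=
  G.MemW12 u ∧ G.IntegrableV fun x => h x * |u x| ^ 2

/-- The norm `‖u‖ = (∫_V (|∇u|² + h |u|²) dμ)^{1/2}` of `W_h^{1,2}(V)`. -/
def normWh (h u : V → ℝ) : ℝ :=
  √(G.integral fun x => G.gradForm u u x + h x * |u x| ^ 2)

/-- `λ₁* = inf ‖u‖² / ∫_V |u|² dμ` over nonzero `u ∈ W_h^{1,2}(V)`. -/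
def lambda1 (h : V → ℝ) : ℝ :=
  sInf {r | ∃ u : V → ℝ, G.MemWh h u ∧ u ≠ 0 ∧
    r = G.normWh h u ^ 2 / G.integral fun x => |u x| ^ 2}

/-- `η₀* = inf b ‖u‖⁴ / ∫_V |u|⁴ dμ` over nonzero `u ∈ W_h^{1,2}(V)`. -/
def eta0 (b : ℝ) (h : V → ℝ) : ℝ :=
  sInf {r | ∃ u : V → ℝ, G.MemWh h u ∧ u ≠ 0 ∧
    r = b * G.normWh h u ^ 4 / G.integral fun x => |u x| ^ 4}

/-- The energy
`J(u) = a/2 ‖u‖² - λ/2 ∫_V |u|² dμ + b/4 ‖u‖⁴ - η/4 ∫_V |u|⁴ dμ` for `u ∈ W_h^{1,2}(V)`. -/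
def J (a b lam eta : ℝ) (h u : V → ℝ) : ℝ :=
  a / 2 * G.normWh h u ^ 2 - lam / 2 * (G.integral fun x => |u x| ^ 2)
    + b / 4 * G.normWh h u ^ 4 - eta / 4 * (G.integral fun x => |u x| ^ 4)

/-- The derivative `⟨J'(u), v⟩` of the energy at `u` in the direction `v`, for
`u, v ∈ W_h^{1,2}(V)`. -/
def derivJ (a b lam eta : ℝ) (h u v : V → ℝ) : ℝ :=
  a * (G.integral fun x => G.gradForm u v x + h x * u x * v x)
    - lam * (G.integral fun x => u x * v x)
    + b * G.normWh h u ^ 2 * (G.integral fun x => G.gradForm u v x + h x * u x * v x)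
    - eta * (G.integral fun x => |u x| ^ 2 * u x * v x)

/-- The Nehari set `{u ∈ W_h^{1,2}(V) : u ≠ 0, ⟨J'(u), u⟩ = 0}`. -/
def nehari (a b lam eta : ℝ) (h : V → ℝ) : Set (V → ℝ) :=
  {u | G.MemWh h u ∧ u ≠ 0 ∧ G.derivJ a b lam eta h u u = 0}

/-- `u ∈ W_h^{1,2}(V)` is a nontrivial solution of
`(a + b ‖u‖²) (-Δu + h u) = λ u + η |u|² u`, which holds at every vertex. -/
def IsNontrivialSolution (a b lam eta : ℝ) (h u : V → ℝ) : Prop :=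
  G.MemWh h u ∧ u ≠ 0 ∧
    ∀ x, (a + b * G.normWh h u ^ 2) * (-G.laplacian u x + h x * u x)
      = lam * u x + eta * |u x| ^ 2 * u x

/-- A least energy solution: a nontrivial solution whose energy is minimal among all nontrivial
solutions. -/
def IsLeastEnergySolution (a b lam eta : ℝ) (h u : V → ℝ) : Prop :=
  G.IsNontrivialSolution a b lam eta h u ∧
    ∀ v, G.IsNontrivialSolution a b lam eta h v → G.J a b lam eta h u ≤ G.J a b lam eta h v

end

end WeightedGraph

/-! Write `P` for `quadPart` and `Q` for `quartPart`, so that `J = P/2 - Q/4`, with `P` and `Q`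
homogeneous of degrees 2 and 4. Testing the equation with `u` gives `P u = Q u`, i.e. membership in
the Nehari set. Below `a λ₁*` the form `P` is positive, while `η ≤ η₀*` forces `Q ≤ 0`: no solution
exists.

If `η > η₀*`, then `Q` is positive somewhere, and one maximizes the scale-invariant quotient `Q /
P²`. Since `h` tends to infinity, second and fourth moments are continuous along energy-bounded
pointwise limits (`exists_limit_of_bounded`), and energy lost in the limit only raises the quotient.
A maximizer scaled to `P = Q` minimizes `J = P/4` on the Nehari set, and varying it by vertex
indicators gives the equation (`equation_of_maximizer`).

Two facts link pointwise and variational statements. Finite energy already implies membership in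
`W_h^{1,2}(V)` (`memWh_iff`), because a function orthogonal to all indicators solves `-Δv + h v = 0`
and vanishes by a maximum principle. By the same density, pointwise solutions may be tested with
themselves (`normWh_sq_of_solution`). -/

namespace WeightedGraph

noncomputable section

open Filter Topology

variable {V : Type*} (G : WeightedGraph V)

/-! ### Isometric embedding into a Hilbert sum -/

/-- The weighted form `μ (∇u ⬝ ∇v + h u v)`, whose sum over `V` is the inner product of
`W_h^{1,2}(V)`. -/
def localForm (h u v : V → ℝ) (x : V) : ℝ := G.μ x * (G.gradForm u v x + h x * u x * v x)

/-- The fibre over `x` of the Hilbert space in which `W_h^{1,2}(V)` embeds isometrically: one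
coordinate for the value at `x` and one for each edge at `x`. -/
abbrev Fibre (x : V) : Type _ := EuclideanSpace ℝ (Option (G.nbrs x))

/-- The isometric embedding of functions of finite energy, as a map into the product of fibres. -/
def jet (h u : V → ℝ) (x : V) : G.Fibre x :=
  WithLp.toLp 2 fun o => o.elim (√(G.μ x * h x) * u x)
    fun y => √(G.weight x y / 2) * (u y - u x)

/-- The energy `∫ (|∇u|² + h |u|²) dμ` is finite. -/
def FiniteEnergy (h u : V → ℝ) : Prop := Summable (G.localForm h u u)

variable {G}

lemma mem_nbrs {x y : V} : y ∈ G.nbrs x ↔ G.graph.Adj x y := by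
  simp [nbrs]

lemma mul_gradForm (u v : V → ℝ) (x : V) :
    G.μ x * G.gradForm u v x =
      ∑ y ∈ G.nbrs x, G.weight x y / 2 * ((u y - u x) * (v y - v x)) := by
  have := (G.μ_pos x).ne'
  rw [gradForm, Finset.mul_sum, Finset.mul_sum]
  refine Finset.sum_congr rfl fun y _ => ?_
  field_simp

lemma mul_gradForm_self_nonneg (u : V → ℝ) (x : V) : 0 ≤ G.μ x * G.gradForm u u x := by
  rw [mul_gradForm]
  refine Finset.sum_nonneg fun y hy => ?_
  have := G.weight_pos x y (mem_nbrs.1 hy)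
  have := mul_self_nonneg (u y - u x)
  positivity

lemma localForm_eq (h u v : V → ℝ) (x : V) :
    G.localForm h u v x = G.μ x * G.gradForm u v x + G.μ x * (h x * (u x * v x)) := by
  rw [localForm]; ring

lemma localForm_self_nonneg {h : V → ℝ} (hh : ∀ x, 0 < h x) (u : V → ℝ) (x : V) :
    0 ≤ G.localForm h u u x := by
  rw [localForm_eq]
  have := mul_gradForm_self_nonneg (G := G) u x
  have := G.μ_pos x
  have := hh x
  have := mul_self_nonneg (u x)
  positivity

lemma mul_sq_le_localForm (h u : V → ℝ) (x : V) :
    G.μ x * (h x * u x ^ 2) ≤ G.localForm h u u x := by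
  rw [localForm_eq]
  have := mul_gradForm_self_nonneg (G := G) u x
  linarith [sq (u x)]

lemma inner_jet {h : V → ℝ} (hh : ∀ x, 0 < h x) (u v : V → ℝ) (x : V) :
    inner ℝ (G.jet h u x) (G.jet h v x) = G.localForm h u v x := by
  have h1 : 0 ≤ G.μ x * h x := (mul_pos (G.μ_pos x) (hh x)).le
  have h2 := Real.mul_self_sqrt h1
  rw [PiLp.inner_apply, Fintype.sum_option, localForm_eq, mul_gradForm,
    ← Finset.sum_coe_sort (G.nbrs x), add_comm]
  simp only [jet, Option.elim, RCLike.inner_apply, conj_trivial]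
  congr 1
  · refine Finset.sum_congr rfl fun y _ => ?_
    have h3 : 0 ≤ G.weight x y / 2 := by
      have := G.weight_pos x y (mem_nbrs.1 y.2)
      positivity
    linear_combination ((u y - u x) * (v y - v x)) * Real.mul_self_sqrt h3
  · linear_combination (u x * v x) * h2

lemma norm_sq_jet {h : V → ℝ} (hh : ∀ x, 0 < h x) (u : V → ℝ) (x : V) :
    ‖G.jet h u x‖ ^ 2 = G.localForm h u u x := by
  rw [← inner_jet hh, real_inner_self_eq_norm_sq]

lemma memℓp_jet {h : V → ℝ} (hh : ∀ x, 0 < h x) {u : V → ℝ} :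
    Memℓp (G.jet h u) 2 ↔ G.FiniteEnergy h u := by
  rw [memℓp_gen_iff (by norm_num)]
  simp only [ENNReal.toReal_ofNat, Real.rpow_ofNat, norm_sq_jet hh, FiniteEnergy]

lemma jet_add (h u v : V → ℝ) : G.jet h (u + v) = G.jet h u + G.jet h v := by
  ext x (_ | y) <;> simp [jet] <;> ring

lemma jet_smul (h : V → ℝ) (c : ℝ) (u : V → ℝ) : G.jet h (c • u) = c • G.jet h u := by
  ext x (_ | y) <;> simp [jet] <;> ring

lemma jet_sub (h u v : V → ℝ) : G.jet h (u - v) = G.jet h u - G.jet h v := by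
  ext x (_ | y) <;> simp [jet] <;> ring

lemma FiniteEnergy.add {h : V → ℝ} (hh : ∀ x, 0 < h x) {u v : V → ℝ} (hu : G.FiniteEnergy h u)
    (hv : G.FiniteEnergy h v) : G.FiniteEnergy h (u + v) := by
  rw [← memℓp_jet hh] at *
  rw [jet_add]; exact hu.add hv

lemma FiniteEnergy.sub {h : V → ℝ} (hh : ∀ x, 0 < h x) {u v : V → ℝ} (hu : G.FiniteEnergy h u)
    (hv : G.FiniteEnergy h v) : G.FiniteEnergy h (u - v) := by
  rw [← memℓp_jet hh] at *
  rw [jet_sub]; exact hu.sub hv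

lemma FiniteEnergy.smul {h : V → ℝ} (hh : ∀ x, 0 < h x) {u : V → ℝ} (c : ℝ)
    (hu : G.FiniteEnergy h u) : G.FiniteEnergy h (c • u) := by
  rw [← memℓp_jet hh] at *
  rw [jet_smul]; exact hu.const_smul c

lemma finiteEnergy_of_finite_support (h : V → ℝ) {u : V → ℝ} (hu : u.support.Finite) :
    G.FiniteEnergy h u := by
  have hfin : (⋃ z ∈ u.support, ({z} ∪ {y | G.graph.Adj z y})).Finite :=
    hu.biUnion fun z _ => (Set.finite_singleton z).union (G.locallyFinite z)
  refine summable_of_ne_finset_zero (s := hfin.toFinset) fun x hx => ?_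
  simp only [Set.Finite.mem_toFinset, Set.mem_iUnion, not_exists, Function.mem_support,
    Set.mem_union, Set.mem_singleton_iff, Set.mem_ofPred_eq, not_or] at hx
  have h0 : u x = 0 := by
    by_contra hne
    exact (hx x hne).1 rfl
  rw [localForm_eq, mul_gradForm, h0, Finset.sum_eq_zero]
  · simp
  · intro y hy
    have : u y = 0 := by
      by_contra hne
      exact (hx y hne).2 (mem_nbrs.1 hy).symm
    simp [this]

/-- A function of finite energy, as an element of the Hilbert sum of the fibres. -/
def embed {h : V → ℝ} (hh : ∀ x, 0 < h x) {u : V → ℝ} (hu : G.FiniteEnergy h u) : lp G.Fibre 2 :=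
  ⟨G.jet h u, (memℓp_jet hh).2 hu⟩

lemma hasSum_inner_embed {h : V → ℝ} (hh : ∀ x, 0 < h x) {u v : V → ℝ}
    (hu : G.FiniteEnergy h u) (hv : G.FiniteEnergy h v) :
    HasSum (G.localForm h u v) (inner ℝ (embed hh hu) (embed hh hv)) := by
  have := lp.hasSum_inner (𝕜 := ℝ) (embed hh hu) (embed hh hv)
  simpa only [embed, inner_jet hh] using this

/-- No finiteness is needed: for infinite energy both sides take the default value 0. -/
lemma normWh_sq {h : V → ℝ} (hh : ∀ x, 0 < h x) (u : V → ℝ) :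
    G.normWh h u ^ 2 = ∑' x, G.localForm h u u x := by
  have he : ∀ x, G.μ x * (G.gradForm u u x + h x * |u x| ^ 2) = G.localForm h u u x := fun x => by
    rw [localForm, sq_abs]; ring
  rw [normWh, integral, Real.sq_sqrt]
  · simp only [he]
  · exact tsum_nonneg fun x => by rw [he]; exact localForm_self_nonneg hh u x

lemma normWh_nonneg (h u : V → ℝ) : 0 ≤ G.normWh h u := Real.sqrt_nonneg _

lemma normWh_eq_norm_embed {h : V → ℝ} (hh : ∀ x, 0 < h x) {u : V → ℝ}
    (hu : G.FiniteEnergy h u) : G.normWh h u = ‖embed hh hu‖ := by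
  rw [← sq_eq_sq₀ (normWh_nonneg h u) (norm_nonneg _), normWh_sq hh,
    (hasSum_inner_embed hh hu hu).tsum_eq, real_inner_self_eq_norm_sq]

/-! ### Vertex indicators and integration by parts -/

/-- The indicator function of a vertex. -/
def delta (z : V) : V → ℝ := Set.indicator {z} 1

lemma delta_self (z : V) : delta z z = 1 := by simp [delta]

lemma delta_of_ne {x z : V} (hx : x ≠ z) : delta z x = 0 := by simp [delta, hx]

lemma finiteEnergy_delta (h : V → ℝ) (z : V) : G.FiniteEnergy h (delta z) :=
  finiteEnergy_of_finite_support h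
    ((Set.finite_singleton z).subset (Set.support_indicator_subset))

/-- Integration by parts against the indicator function of a vertex. -/
lemma hasSum_localForm_delta (h u : V → ℝ) (z : V) :
    HasSum (G.localForm h u (delta z)) (G.μ z * (-G.laplacian u z + h z * u z)) := by
  classical
  have hz : z ∉ G.nbrs z := fun hz => G.graph.loopless.irrefl z (mem_nbrs.1 hz)
  have hval : G.μ z * (-G.laplacian u z + h z * u z) =
      ∑ x ∈ insert z (G.nbrs z), G.localForm h u (delta z) x := by
    rw [Finset.sum_insert hz, localForm_eq, mul_gradForm, delta_self]
    -- Each edge at `z` is counted with weight `w/2` once from either end: `h1` is the half seen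
    -- from `z`, `h2` the half seen from the neighbours.
    have h1 : ∑ y ∈ G.nbrs z, G.weight z y / 2 * ((u y - u z) * (delta z y - 1)) =
        - ∑ y ∈ G.nbrs z, G.weight z y / 2 * (u y - u z) := by
      rw [← Finset.sum_neg_distrib]
      refine Finset.sum_congr rfl fun y hy => ?_
      rw [delta_of_ne (by rintro rfl; exact hz hy)]; ring
    have h2 : ∑ x ∈ G.nbrs z, G.localForm h u (delta z) x =
        - ∑ y ∈ G.nbrs z, G.weight z y / 2 * (u y - u z) := by
      rw [← Finset.sum_neg_distrib]
      refine Finset.sum_congr rfl fun x hx => ?_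
      have hxz : x ≠ z := fun e => hz (e ▸ hx)
      have hadj := mem_nbrs.1 hx
      rw [localForm_eq, mul_gradForm, delta_of_ne hxz, Finset.sum_eq_single z]
      · rw [delta_self, G.weight_symm z x hadj]; ring
      · intro y _ hy
        rw [delta_of_ne hy]; ring
      · intro h'
        exact absurd (mem_nbrs.2 hadj.symm) h'
    rw [h1, h2, laplacian]
    have hμ := (G.μ_pos z).ne'
    have h3 : ∑ y ∈ G.nbrs z, G.weight z y / 2 * (u y - u z) =
        (∑ y ∈ G.nbrs z, G.weight z y * (u y - u z)) / 2 := by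
      rw [Finset.sum_div]
      exact Finset.sum_congr rfl fun y _ => by ring
    rw [h3]
    field_simp
    ring
  rw [hval]
  refine hasSum_sum_of_ne_finset_zero fun x hx => ?_
  rw [Finset.mem_insert, not_or] at hx
  rw [localForm_eq, mul_gradForm, delta_of_ne hx.1, Finset.sum_eq_zero]
  · ring
  · intro y hy
    have : y ≠ z := by
      rintro rfl
      exact hx.2 (mem_nbrs.2 (mem_nbrs.1 hy).symm)
    rw [delta_of_ne this]; ring

/-- The span of the indicator functions of vertices. -/
def deltaSpan (G : WeightedGraph V) {h : V → ℝ} (hh : ∀ x, 0 < h x) :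
    Submodule ℝ (lp G.Fibre 2) :=
  Submodule.span ℝ (Set.range fun z => embed hh (G.finiteEnergy_delta h z))

lemma exists_of_mem_deltaSpan {h : V → ℝ} (hh : ∀ x, 0 < h x) {f : lp G.Fibre 2}
    (hf : f ∈ G.deltaSpan hh) :
    ∃ φ : V → ℝ, φ.support.Finite ∧ (f : ∀ x, G.Fibre x) = G.jet h φ := by
  induction hf using Submodule.span_induction with
  | mem x hx =>
    obtain ⟨z, rfl⟩ := hx
    exact ⟨delta z, (Set.finite_singleton z).subset Set.support_indicator_subset, rfl⟩
  | zero => exact ⟨0, by simp, by ext x (_ | y) <;> simp [jet]⟩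
  | add f g _ _ hf hg =>
    obtain ⟨φ, h1, h2⟩ := hf
    obtain ⟨ψ, h3, h4⟩ := hg
    exact ⟨φ + ψ, (h1.union h3).subset (Function.support_add φ ψ), by
      rw [jet_add, ← h2, ← h4]; rfl⟩
  | smul c f _ hf =>
    obtain ⟨φ, h1, h2⟩ := hf
    exact ⟨c • φ, h1.subset (Function.support_const_smul_subset c φ), by
      rw [jet_smul, ← h2]; rfl⟩

/-- The value coordinates determine `u`, as `μ h > 0`; being a jet then means that each edge
coordinate matches the values at its ends, a family of equations between continuous functionals. -/
lemma isClosed_setOf_jet {h : V → ℝ} (hh : ∀ x, 0 < h x) :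
    IsClosed {f : lp G.Fibre 2 | ∃ u, (f : ∀ x, G.Fibre x) = G.jet h u} := by
  have hpos : ∀ x, √(G.μ x * h x) ≠ 0 := fun x =>
    (Real.sqrt_pos.2 (mul_pos (G.μ_pos x) (hh x))).ne'
  have hset : {f : lp G.Fibre 2 | ∃ u, (f : ∀ x, G.Fibre x) = G.jet h u} =
      ⋂ (x : V) (y : G.nbrs x), {f : lp G.Fibre 2 | f x (some y) =
        √(G.weight x y / 2) * (f y none / √(G.μ y * h y) - f x none / √(G.μ x * h x))} := by
    ext f
    simp only [Set.mem_iInter, Set.mem_ofPred_eq]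
    constructor
    · rintro ⟨u, hu⟩ x y
      rw [hu]
      simp [jet, hpos]
    · intro hf
      refine ⟨fun x => f x none / √(G.μ x * h x), ?_⟩
      ext x (_ | y)
      · simp only [jet, Option.elim]
        field_simp [hpos x]
      · rw [hf x y]; rfl
  have hc : ∀ x (o : Option (G.nbrs x)), Continuous fun f : lp G.Fibre 2 => f x o := fun x o =>
    (EuclideanSpace.proj (𝕜 := ℝ) o).continuous.comp (lp.evalCLM ℝ G.Fibre 2 x).continuous
  rw [hset]
  refine isClosed_iInter fun x => isClosed_iInter fun y => isClosed_eq (hc _ _) ?_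
  exact continuous_const.mul (((hc _ _).div_const _).sub ((hc _ _).div_const _))

end

end WeightedGraph

/-! ### Maximum principle and density of finitely supported functions -/

namespace WeightedGraph

noncomputable section

open Filter Topology

variable {V : Type*} {G : WeightedGraph V}

lemma FiniteEnergy.summable_gradForm {h : V → ℝ} (hh : ∀ x, 0 < h x) {u : V → ℝ}
    (hu : G.FiniteEnergy h u) : Summable fun x => G.μ x * G.gradForm u u x := by
  refine hu.of_nonneg_of_le (fun x => mul_gradForm_self_nonneg u x) fun x => ?_
  rw [localForm_eq]
  have := G.μ_pos x
  have := hh x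
  have := mul_self_nonneg (u x)
  have : 0 ≤ G.μ x * (h x * (u x * u x)) := by positivity
  linarith

lemma FiniteEnergy.summable_mul_sq {h : V → ℝ} (hh : ∀ x, 0 < h x) {u : V → ℝ}
    (hu : G.FiniteEnergy h u) : Summable fun x => G.μ x * (h x * u x ^ 2) := by
  refine hu.of_nonneg_of_le (fun x => ?_) fun x => mul_sq_le_localForm h u x
  have := G.μ_pos x
  have := hh x
  positivity

lemma finiteEnergy_of_summable {h u : V → ℝ} (h1 : Summable fun x => G.μ x * G.gradForm u u x)
    (h2 : Summable fun x => G.μ x * (h x * u x ^ 2)) : G.FiniteEnergy h u :=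
  (h1.add h2).congr fun x => by rw [localForm_eq]; ring

lemma FiniteEnergy.summable_sq {h : V → ℝ} {h₀ : ℝ} (hh₀ : 0 < h₀) (H : ∀ x, h₀ ≤ h x)
    {u : V → ℝ} (hu : G.FiniteEnergy h u) : Summable fun x => G.μ x * u x ^ 2 := by
  have h1 := (hu.summable_mul_sq fun x => hh₀.trans_le (H x)).mul_left h₀⁻¹
  refine h1.of_nonneg_of_le (fun x => ?_) fun x => ?_
  · have := G.μ_pos x
    positivity
  · have h2 := mul_le_mul_of_nonneg_right (H x)
      (mul_nonneg (G.μ_pos x).le (sq_nonneg (u x)))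
    rw [inv_mul_eq_div, le_div_iff₀ hh₀]
    linarith

/-- A subsolution of `-Δv + h v = 0` that is square summable is nonpositive, the measure being
bounded below. -/
lemma nonpos_of_mul_le_laplacian {μ₀ : ℝ} (hμ₀ : 0 < μ₀) (hμ : ∀ x, μ₀ ≤ G.μ x) {h : V → ℝ}
    (hh : ∀ x, 0 < h x) {v : V → ℝ} (hv : Summable fun x => G.μ x * v x ^ 2)
    (hsol : ∀ x, h x * v x ≤ G.laplacian v x) (x₀ : V) : v x₀ ≤ 0 := by
  by_contra! hpos
  -- Square summability with `μ ≥ μ₀` makes this superlevel set finite, so `v` attains a positive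
  -- maximum, where the Laplacian is nonpositive although `h v > 0`.
  have hfin : {x | v x₀ ≤ v x}.Finite := by
    have h1 := hv.tendsto_cofinite_zero.eventually (gt_mem_nhds
      (show 0 < μ₀ * v x₀ ^ 2 by positivity))
    refine (Filter.eventually_cofinite.1 h1).subset fun x hx => ?_
    have hx : v x₀ ≤ v x := hx
    simp only [Set.mem_ofPred_eq, not_lt]
    have := hμ x
    have := (G.μ_pos x).le
    gcongr
  obtain ⟨x, hx, hmax⟩ := hfin.exists_maximalFor v _ ⟨x₀, le_refl (v x₀)⟩
  have hx : v x₀ ≤ v x := hx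
  have h1 : 0 < G.laplacian v x := (mul_pos (hh x) (hpos.trans_le hx)).trans_le (hsol x)
  refine h1.not_ge (mul_nonpos_of_nonneg_of_nonpos ?_ (Finset.sum_nonpos fun y hy => ?_))
  · have := G.μ_pos x
    positivity
  · refine mul_nonpos_of_nonneg_of_nonpos (G.weight_pos x y (mem_nbrs.1 hy)).le ?_
    rw [sub_nonpos]
    by_contra! hlt
    exact hlt.not_ge (hmax (hx.trans hlt.le) hlt.le)

lemma laplacian_neg (v : V → ℝ) (x : V) : G.laplacian (-v) x = -G.laplacian v x := by
  rw [laplacian, laplacian, ← mul_neg, ← Finset.sum_neg_distrib]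
  congr 1
  exact Finset.sum_congr rfl fun y _ => by simp only [Pi.neg_apply]; ring

lemma eq_zero_of_laplacian_eq {μ₀ : ℝ} (hμ₀ : 0 < μ₀) (hμ : ∀ x, μ₀ ≤ G.μ x) {h : V → ℝ}
    (hh : ∀ x, 0 < h x) {v : V → ℝ} (hv : Summable fun x => G.μ x * v x ^ 2)
    (hsol : ∀ x, -G.laplacian v x + h x * v x = 0) : v = 0 := by
  funext x
  refine le_antisymm (nonpos_of_mul_le_laplacian hμ₀ hμ hh hv (fun x => ?_) x) ?_
  · linarith [hsol x]
  · have := nonpos_of_mul_le_laplacian hμ₀ hμ hh (v := -v) (by simpa using hv)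
      (fun x => by rw [laplacian_neg, Pi.neg_apply]; linarith [hsol x]) x
    simpa using this

/-- Finitely supported functions are dense among the functions of finite energy. -/
lemma embed_mem_closure_deltaSpan {μ₀ : ℝ} (hμ₀ : 0 < μ₀) (hμ : ∀ x, μ₀ ≤ G.μ x) {h : V → ℝ}
    {h₀ : ℝ} (hh₀ : 0 < h₀) (H : ∀ x, h₀ ≤ h x) (hh : ∀ x, 0 < h x) {u : V → ℝ}
    (hu : G.FiniteEnergy h u) : embed hh hu ∈ (G.deltaSpan hh).topologicalClosure := by
  have hcomplete : CompleteSpace (G.deltaSpan hh).topologicalClosure :=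
    (Submodule.isClosed_topologicalClosure _).completeSpace_coe
  obtain ⟨f, hf, g, hg, hfg⟩ :=
    Submodule.exists_add_mem_mem_orthogonal (K := (G.deltaSpan hh).topologicalClosure)
      (embed hh hu)
  -- The projection is again a jet because jets form a closed set, so the orthogonal remainder is
  -- the jet of `u - φ`, a genuine function.
  obtain ⟨φ, hφ⟩ : ∃ φ, (f : ∀ x, G.Fibre x) = G.jet h φ := by
    refine (isClosed_setOf_jet hh).closure_subset_iff.2 (fun k hk => ?_) hf
    obtain ⟨φ, -, hφ⟩ := exists_of_mem_deltaSpan hh hk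
    exact ⟨φ, hφ⟩
  have hgv : (g : ∀ x, G.Fibre x) = G.jet h (u - φ) := by
    rw [jet_sub, ← hφ, eq_sub_of_add_eq' hfg.symm]
    rfl
  have hv : G.FiniteEnergy h (u - φ) := by
    rw [← memℓp_jet hh, ← hgv]; exact g.2
  have hge : g = embed hh hv := Subtype.ext hgv
  have h0 : u - φ = 0 := by
    refine eq_zero_of_laplacian_eq hμ₀ hμ hh (hv.summable_sq hh₀ H) fun z => ?_
    have h1 := hasSum_inner_embed hh hv (G.finiteEnergy_delta h z)
    rw [← hge, real_inner_comm, (Submodule.mem_orthogonal _ _).1 hg _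
      (Submodule.le_topologicalClosure _ (Submodule.subset_span ⟨z, rfl⟩))] at h1
    have h2 := (hasSum_localForm_delta h _ z).unique h1
    exact (mul_eq_zero.1 h2).resolve_left (G.μ_pos z).ne'
  have hg0 : g = 0 := by
    refine Subtype.ext ?_
    rw [hgv, h0, ← sub_self (0 : V → ℝ), jet_sub, sub_self]
    rfl
  rw [hfg, hg0, add_zero]
  exact hf

lemma densityW12_mul (u : V → ℝ) (x : V) :
    G.μ x * G.densityW12 u x = G.localForm 1 u u x := by
  rw [densityW12, localForm, sq_abs, Pi.one_apply]; ring

/-- On a graph whose measure is bounded below, `W_h^{1,2}(V)` consists of all functions of finite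
energy. -/
lemma memWh_iff {μ₀ : ℝ} (hμ₀ : 0 < μ₀) (hμ : ∀ x, μ₀ ≤ G.μ x) {h : V → ℝ}
    {h₀ : ℝ} (hh₀ : 0 < h₀) (H : ∀ x, h₀ ≤ h x) {u : V → ℝ} :
    G.MemWh h u ↔ G.FiniteEnergy h u := by
  have h1 : ∀ x : V, 0 < (1 : V → ℝ) x := fun _ => one_pos
  have hh : ∀ x, 0 < h x := fun x => hh₀.trans_le (H x)
  constructor
  · rintro ⟨hu, hi⟩
    -- One approximation suffices: `u = (u - φ) + φ`, both of finite energy for the potential 1.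
    obtain ⟨φ, hφ, hint, -⟩ := hu 1 one_pos
    have hsub : G.FiniteEnergy 1 (u - φ) := hint.congr fun x => densityW12_mul _ x
    have := hsub.add h1 (finiteEnergy_of_finite_support (G := G) 1 hφ)
    rw [sub_add_cancel] at this
    refine finiteEnergy_of_summable (this.summable_gradForm h1) ?_
    simpa only [IntegrableV, sq_abs] using hi
  · intro hu
    have hu1 : G.FiniteEnergy 1 u := finiteEnergy_of_summable (hu.summable_gradForm hh) (by
      simpa using hu.summable_sq hh₀ H)
    refine ⟨fun ε hε => ?_, by
      simpa only [IntegrableV, sq_abs] using hu.summable_mul_sq hh⟩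
    -- The norm of `W^{1,2}` is the energy norm of the constant potential 1, so density is applied
    -- with `h = 1`.
    obtain ⟨k, hk, hd⟩ := Metric.mem_closure_iff.1
      (embed_mem_closure_deltaSpan hμ₀ hμ one_pos (fun _ => le_rfl) h1 hu1) ε hε
    obtain ⟨φ, hφ, hkφ⟩ := exists_of_mem_deltaSpan h1 hk
    have hφE := finiteEnergy_of_finite_support (G := G) 1 hφ
    have hsub : G.FiniteEnergy 1 (u - φ) := hu1.sub h1 hφE
    refine ⟨φ, hφ, hsub.congr fun x => (densityW12_mul _ x).symm, ?_⟩
    have hn : √(G.integral (G.densityW12 (u - φ))) = G.normWh 1 (u - φ) := by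
      rw [← Real.sqrt_sq (normWh_nonneg (G := G) 1 (u - φ)), normWh_sq h1, integral]
      simp only [densityW12_mul]
    have he : embed h1 hsub = embed h1 hu1 - k := by
      refine Subtype.ext ?_
      rw [AddSubgroup.coe_sub, hkφ]
      exact jet_sub 1 u φ
    rwa [hn, normWh_eq_norm_embed h1 hsub, he, ← dist_eq_norm]

/-! ### Finiteness of balls and of sublevel sets of the potential -/

lemma finite_dist_le (G : WeightedGraph V) (x₀ : V) (n : ℕ) :
    {x | G.graph.dist x x₀ ≤ n}.Finite := by
  induction n with
  | zero =>
    refine (Set.finite_singleton x₀).subset fun x hx => ?_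
    have hx : G.graph.dist x x₀ ≤ 0 := hx
    exact (G.connected.dist_eq_zero_iff).1 (Nat.le_zero.1 hx)
  | succ n ih =>
    refine (ih.union (ih.biUnion fun z _ => G.locallyFinite z)).subset fun x hx => ?_
    have hx : G.graph.dist x x₀ ≤ n + 1 := hx
    obtain ⟨p, hp⟩ := G.connected.exists_walk_length_eq_dist x x₀
    cases p with
    | nil =>
      left
      simp
    | cons hadj q =>
      right
      simp only [Set.mem_iUnion]
      refine ⟨_, ?_, hadj.symm⟩
      have := SimpleGraph.dist_le q
      rw [SimpleGraph.Walk.length_cons] at hp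
      change _ ≤ n
      omega

lemma finite_le_of_tendsto {h : V → ℝ} {x₀ : V}
    (H : Tendsto h (comap (fun x => G.graph.dist x x₀) atTop) atTop) (M : ℝ) :
    {x | h x ≤ M}.Finite := by
  have h1 := H.eventually (eventually_gt_atTop M)
  rw [eventually_comap, eventually_atTop] at h1
  obtain ⟨n, hn⟩ := h1
  refine (finite_dist_le G x₀ n).subset fun x hx => ?_
  have hx : h x ≤ M := hx
  change G.graph.dist x x₀ ≤ n
  by_contra! hlt
  exact (hn _ hlt.le x rfl).not_ge hx

end

end WeightedGraph

/-! ### Limits of weighted sums -/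

open Filter Topology in
/-- A form of Fatou's lemma for sums of nonnegative functions. -/
lemma summable_and_tsum_le_of_tendsto {ι V : Type*} {l : Filter ι} [l.NeBot] {f : ι → V → ℝ}
    {g : V → ℝ} {C : ℝ} (hf : ∀ n x, 0 ≤ f n x) (hs : ∀ n, Summable (f n))
    (hC : ∀ n, ∑' x, f n x ≤ C) (hlim : ∀ x, Tendsto (fun n => f n x) l (𝓝 (g x))) :
    Summable g ∧ ∑' x, g x ≤ C := by
  have hg : ∀ x, 0 ≤ g x := fun x => ge_of_tendsto' (hlim x) fun n => hf n x
  have hle : ∀ s : Finset V, ∑ x ∈ s, g x ≤ C := fun s =>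
    le_of_tendsto' (tendsto_finsetSum s fun x _ => hlim x) fun n =>
      ((hs n).sum_le_tsum s fun x _ => hf n x).trans (hC n)
  have hsum := summable_of_sum_le hg hle
  exact ⟨hsum, hsum.tsum_le_of_sum_le hle⟩

/-- Markov's inequality: where `h > M`, one has `f ≤ h f / M`. The tail bound is uniform over all
`f` with the same `C`. -/
lemma tsum_le_sum_add_of_weight {V : Type*} {f h : V → ℝ} {C M : ℝ} (hM : 0 < M)
    (hfin : {x | h x ≤ M}.Finite) (hf : ∀ x, 0 ≤ f x) (hh : ∀ x, 0 ≤ h x) (hsf : Summable f)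
    (hs : Summable fun x => h x * f x) (hC : ∑' x, h x * f x ≤ C) :
    ∑' x, f x ≤ ∑ x ∈ hfin.toFinset, f x + C / M := by
  classical
  have h1 : ∑' x, f x ≤ ∑' x, ((hfin.toFinset : Set V).indicator f x + h x * f x / M) := by
    refine hsf.tsum_le_tsum (fun x => ?_) ((hsf.indicator _).add (hs.div_const M))
    by_cases hx : h x ≤ M
    · rw [Set.indicator_of_mem (by simpa using hx)]
      have := hf x
      have := hh x
      have : 0 ≤ h x * f x / M := by positivity
      linarith
    · rw [Set.indicator_of_notMem (by simpa using hx), zero_add, le_div_iff₀ hM, mul_comm]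
      exact mul_le_mul_of_nonneg_right (not_le.1 hx).le (hf x)
  rw [(hsf.indicator _).tsum_add (hs.div_const M), tsum_div_const,
    ← sum_eq_tsum_indicator] at h1
  have : (∑' x, h x * f x) / M ≤ C / M := by gcongr
  linarith

open Filter Topology in
/-- Sums of nonnegative functions that are bounded against a weight tending to infinity pass to
pointwise limits. -/
lemma tendsto_tsum_of_weight {ι V : Type*} {l : Filter ι} [l.NeBot] {f : ι → V → ℝ} {g h : V → ℝ}
    {h₀ C : ℝ} (hh₀ : 0 < h₀) (H : ∀ x, h₀ ≤ h x) (hfin : ∀ M, {x | h x ≤ M}.Finite)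
    (hf : ∀ n x, 0 ≤ f n x) (hs : ∀ n, Summable fun x => h x * f n x)
    (hC : ∀ n, ∑' x, h x * f n x ≤ C) (hlim : ∀ x, Tendsto (fun n => f n x) l (𝓝 (g x))) :
    Tendsto (fun n => ∑' x, f n x) l (𝓝 (∑' x, g x)) := by
  have hh : ∀ x, 0 ≤ h x := fun x => hh₀.le.trans (H x)
  have hg : ∀ x, 0 ≤ g x := fun x => ge_of_tendsto' (hlim x) fun n => hf n x
  obtain ⟨hgs, hgC⟩ := summable_and_tsum_le_of_tendsto (fun n x => mul_nonneg (hh x) (hf n x)) hs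
    hC fun x => (hlim x).const_mul (h x)
  have hplain : ∀ {k : V → ℝ}, (∀ x, 0 ≤ k x) → (Summable fun x => h x * k x) → Summable k := by
    intro k hk hks
    refine (hks.mul_left h₀⁻¹).of_nonneg_of_le hk fun x => ?_
    rw [inv_mul_eq_div, le_div_iff₀ hh₀, mul_comm]
    exact mul_le_mul_of_nonneg_right (H x) (hk x)
  have hC0 : 0 ≤ C := (tsum_nonneg fun x => mul_nonneg (hh x) (hg x)).trans hgC
  rw [Metric.tendsto_nhds]
  intro ε hε
  -- The cutoff `M = 2(C + 1)/ε` makes the tail `C/M` less than `ε/2`; the `+ 1` keeps `M` positive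
  -- when `C = 0`.
  have hM : 0 < 2 * (C + 1) / ε := by positivity
  have hCM : C / (2 * (C + 1) / ε) < ε / 2 := by
    rw [div_lt_iff₀ hM]
    have : ε / 2 * (2 * (C + 1) / ε) = C + 1 := by field_simp
    linarith
  have h1 := tendsto_finsetSum (hfin (2 * (C + 1) / ε)).toFinset fun x _ => hlim x
  filter_upwards [Metric.tendsto_nhds.1 h1 (ε / 2) (by positivity)] with n hn
  have hu1 := tsum_le_sum_add_of_weight hM (hfin _) (hf n) hh (hplain (hf n) (hs n)) (hs n) (hC n)
  have hu2 := tsum_le_sum_add_of_weight hM (hfin _) hg hh (hplain hg hgs) hgs hgC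
  have hl1 := (hplain (hf n) (hs n)).sum_le_tsum (hfin (2 * (C + 1) / ε)).toFinset
    fun x _ => hf n x
  have hl2 := (hplain hg hgs).sum_le_tsum (hfin (2 * (C + 1) / ε)).toFinset fun x _ => hg x
  rw [Real.dist_eq, abs_lt] at hn ⊢
  constructor <;> linarith [hn.1, hn.2]

/-! ### Testing with the solution; compactness -/

namespace WeightedGraph

noncomputable section

open Filter Topology

variable {V : Type*} {G : WeightedGraph V}

/-- Testing a pointwise solution of `-Δu + h u = g` with `u` itself. -/
lemma normWh_sq_of_solution {μ₀ : ℝ} (hμ₀ : 0 < μ₀) (hμ : ∀ x, μ₀ ≤ G.μ x) {h : V → ℝ}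
    {h₀ : ℝ} (hh₀ : 0 < h₀) (H : ∀ x, h₀ ≤ h x) {u g : V → ℝ} (hu : G.FiniteEnergy h u)
    (hg : Summable fun x => G.μ x * g x ^ 2) (hsol : ∀ x, -G.laplacian u x + h x * u x = g x) :
    G.normWh h u ^ 2 = ∑' x, G.μ x * (g x * u x) := by
  have hh : ∀ x, 0 < h x := fun x => hh₀.trans_le (H x)
  -- `q` represents the functional `v ↦ ∫ g v dμ`; it need not be a jet, so its edge coordinates may
  -- be zero.
  let q : ∀ x, G.Fibre x := fun x => WithLp.toLp 2 fun o => o.elim (√(G.μ x / h x) * g x) fun _ => 0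
  have hinner : ∀ (v : V → ℝ) x, inner ℝ (q x) (G.jet h v x) = G.μ x * (g x * v x) := by
    intro v x
    have h1 : √(G.μ x / h x) * √(G.μ x * h x) = G.μ x := by
      rw [← Real.sqrt_mul (div_pos (G.μ_pos x) (hh x)).le, ← Real.sqrt_sq (G.μ_pos x).le]
      congr 1
      have := (hh x).ne'
      rw [Real.sqrt_sq (G.μ_pos x).le]
      field_simp
    rw [PiLp.inner_apply, Fintype.sum_option]
    simp only [q, jet, Option.elim, RCLike.inner_apply, conj_trivial, mul_zero,
      Finset.sum_const_zero, add_zero]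
    linear_combination (g x * v x) * h1
  have hq : Memℓp q 2 := by
    rw [memℓp_gen_iff (by norm_num)]
    simp only [ENNReal.toReal_ofNat, Real.rpow_ofNat]
    refine (hg.mul_left h₀⁻¹).of_nonneg_of_le (fun x => by positivity) fun x => ?_
    have hn : ‖q x‖ ^ 2 = G.μ x / h x * g x ^ 2 := by
      rw [EuclideanSpace.real_norm_sq_eq, Fintype.sum_option]
      simp only [q, Option.elim]
      rw [mul_pow, Real.sq_sqrt (div_pos (G.μ_pos x) (hh x)).le]
      simp
    rw [hn, div_eq_inv_mul, mul_assoc]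
    have := G.μ_pos x
    have := H x
    gcongr
  let Q : lp G.Fibre 2 := ⟨q, hq⟩
  have hsum : ∀ {v : V → ℝ} (hv : G.FiniteEnergy h v),
      HasSum (fun x => G.μ x * (g x * v x)) (inner ℝ Q (embed hh hv)) := fun {v} hv => by
    simpa only [hinner, Q, embed] using lp.hasSum_inner (𝕜 := ℝ) Q (embed hh hv)
  -- The equation at `z` says that the difference is orthogonal to `delta z`; by density it is then
  -- orthogonal to `embed hh hu` itself.
  have horth : embed hh hu - Q ∈ (G.deltaSpan hh)ᗮ := by
    rw [deltaSpan, Submodule.mem_orthogonal]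
    intro f hf
    induction hf using Submodule.span_induction with
    | mem f hf =>
      obtain ⟨z, rfl⟩ := hf
      have h1 := (hasSum_inner_embed hh hu (G.finiteEnergy_delta h z)).unique
        (hasSum_localForm_delta h u z)
      have h2 := (hsum (G.finiteEnergy_delta h z)).unique
        (hasSum_single z fun x hx => by rw [delta_of_ne hx]; ring)
      rw [real_inner_comm, inner_sub_left]
      simp only [h1, h2, delta_self, hsol, mul_one, sub_self]
    | zero => exact inner_zero_left _
    | add f k _ _ hf hk => rw [inner_add_left, hf, hk, add_zero]
    | smul c f _ hf => rw [inner_smul_left, hf, mul_zero]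
  rw [← Submodule.orthogonal_closure, Submodule.mem_orthogonal] at horth
  have h0 := horth _ (embed_mem_closure_deltaSpan hμ₀ hμ hh₀ H hh hu)
  rw [real_inner_comm, inner_sub_left, real_inner_self_eq_norm_sq,
    ← normWh_eq_norm_embed hh hu] at h0
  rw [(hsum hu).tsum_eq]
  linarith

lemma mul_sq_le_normWh_sq {h : V → ℝ} (hh : ∀ x, 0 < h x) {u : V → ℝ} (hu : G.FiniteEnergy h u)
    (x : V) : G.μ x * (h x * u x ^ 2) ≤ G.normWh h u ^ 2 := by
  rw [normWh_sq hh]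
  exact (mul_sq_le_localForm h u x).trans
    (hu.le_tsum x fun y _ => localForm_self_nonneg hh u y)

lemma sq_le_normWh_sq {μ₀ : ℝ} (hμ : ∀ x, μ₀ ≤ G.μ x) {h : V → ℝ}
    {h₀ : ℝ} (hh₀ : 0 < h₀) (H : ∀ x, h₀ ≤ h x) {u : V → ℝ} (hu : G.FiniteEnergy h u) (x : V) :
    μ₀ * h₀ * u x ^ 2 ≤ G.normWh h u ^ 2 := by
  have hh : ∀ x, 0 < h x := fun x => hh₀.trans_le (H x)
  refine le_trans ?_ (mul_sq_le_normWh_sq hh hu x)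
  have := hμ x
  have := H x
  have := (hh x).le
  have := (G.μ_pos x).le
  rw [mul_assoc]
  gcongr

lemma FiniteEnergy.summable_mul_pow_four {μ₀ : ℝ} (hμ₀ : 0 < μ₀) (hμ : ∀ x, μ₀ ≤ G.μ x)
    {h : V → ℝ} {h₀ : ℝ} (hh₀ : 0 < h₀) (H : ∀ x, h₀ ≤ h x) {u : V → ℝ}
    (hu : G.FiniteEnergy h u) : Summable fun x => h x * (G.μ x * u x ^ 4) := by
  have hh : ∀ x, 0 < h x := fun x => hh₀.trans_le (H x)
  refine ((hu.summable_mul_sq hh).mul_left (G.normWh h u ^ 2 / (μ₀ * h₀))).of_nonneg_of_le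
    (fun x => ?_) fun x => ?_
  · have := (hh x).le
    have := (G.μ_pos x).le
    positivity
  · have h1 := sq_le_normWh_sq hμ hh₀ H hu x
    have h2 : u x ^ 2 ≤ G.normWh h u ^ 2 / (μ₀ * h₀) := by
      rw [le_div_iff₀ (mul_pos hμ₀ hh₀)]; linarith
    have := mul_le_mul_of_nonneg_right h2
      (mul_nonneg (G.μ_pos x).le (mul_nonneg (hh x).le (sq_nonneg (u x))))
    linarith

lemma tsum_mul_pow_four_le {μ₀ : ℝ} (hμ₀ : 0 < μ₀) (hμ : ∀ x, μ₀ ≤ G.μ x)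
    {h : V → ℝ} {h₀ : ℝ} (hh₀ : 0 < h₀) (H : ∀ x, h₀ ≤ h x) {u : V → ℝ}
    (hu : G.FiniteEnergy h u) :
    ∑' x, h x * (G.μ x * u x ^ 4) ≤ G.normWh h u ^ 4 / (μ₀ * h₀) := by
  have hh : ∀ x, 0 < h x := fun x => hh₀.trans_le (H x)
  have h1 : ∑' x, h x * (G.μ x * u x ^ 4) ≤
      ∑' x, G.normWh h u ^ 2 / (μ₀ * h₀) * G.localForm h u u x := by
    refine (hu.summable_mul_pow_four hμ₀ hμ hh₀ H).tsum_le_tsum (fun x => ?_) (hu.mul_left _)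
    have h1 := sq_le_normWh_sq hμ hh₀ H hu x
    have h2 : u x ^ 2 ≤ G.normWh h u ^ 2 / (μ₀ * h₀) := by
      rw [le_div_iff₀ (mul_pos hμ₀ hh₀)]; linarith
    have h3 := mul_sq_le_localForm (G := G) h u x
    have h4 : 0 ≤ G.μ x * (h x * u x ^ 2) :=
      mul_nonneg (G.μ_pos x).le (mul_nonneg (hh x).le (sq_nonneg (u x)))
    calc h x * (G.μ x * u x ^ 4) = u x ^ 2 * (G.μ x * (h x * u x ^ 2)) := by ring
      _ ≤ _ := mul_le_mul h2 h3 h4 ((sq_nonneg _).trans h2)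
  rw [tsum_mul_left, ← normWh_sq hh] at h1
  exact h1.trans_eq (by ring)

lemma FiniteEnergy.summable_pow_four {μ₀ : ℝ} (hμ₀ : 0 < μ₀) (hμ : ∀ x, μ₀ ≤ G.μ x)
    {h : V → ℝ} {h₀ : ℝ} (hh₀ : 0 < h₀) (H : ∀ x, h₀ ≤ h x) {u : V → ℝ}
    (hu : G.FiniteEnergy h u) : Summable fun x => G.μ x * u x ^ 4 := by
  refine ((hu.summable_mul_pow_four hμ₀ hμ hh₀ H).mul_left h₀⁻¹).of_nonneg_of_le
    (fun x => ?_) fun x => ?_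
  · have := (G.μ_pos x).le
    positivity
  · rw [inv_mul_eq_div, le_div_iff₀ hh₀, mul_comm]
    have := (G.μ_pos x).le
    have := H x
    gcongr

/-- A sequence of bounded energy has a pointwise limit along an ultrafilter, the energy being lower
semicontinuous and the second and fourth moments being continuous. -/
lemma exists_limit_of_bounded {μ₀ : ℝ} (hμ₀ : 0 < μ₀) (hμ : ∀ x, μ₀ ≤ G.μ x)
    {h : V → ℝ} {h₀ : ℝ} (hh₀ : 0 < h₀) (H : ∀ x, h₀ ≤ h x) (hfin : ∀ M, {x | h x ≤ M}.Finite)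
    {u : ℕ → V → ℝ} (hu : ∀ n, G.FiniteEnergy h (u n)) (h1 : ∀ n, G.normWh h (u n) ^ 2 ≤ 1)
    (l : Ultrafilter ℕ) :
    ∃ v, G.FiniteEnergy h v ∧ G.normWh h v ^ 2 ≤ 1 ∧
      Tendsto (fun n => ∑' x, G.μ x * u n x ^ 2) l (𝓝 (∑' x, G.μ x * v x ^ 2)) ∧
      Tendsto (fun n => ∑' x, G.μ x * u n x ^ 4) l (𝓝 (∑' x, G.μ x * v x ^ 4)) := by
  have hh : ∀ x, 0 < h x := fun x => hh₀.trans_le (H x)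
  have hmh := mul_pos hμ₀ hh₀
  -- The energy bounds each value `u n x`, so the ultrafilter gives convergence at all vertices at
  -- once, without a diagonal subsequence.
  have hlim : ∀ x, ∃ c, Tendsto (fun n => u n x) l (𝓝 c) := by
    intro x
    obtain ⟨c, -, hc⟩ := (isCompact_Icc (a := -√(1 / (μ₀ * h₀)))
      (b := √(1 / (μ₀ * h₀)))).ultrafilter_le_nhds (l.map fun n => u n x) (by
        rw [le_principal_iff, Ultrafilter.coe_map, mem_map]
        refine univ_mem' fun n => ?_
        have := (sq_le_normWh_sq hμ hh₀ H (hu n) x).trans (h1 n)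
        refine abs_le.1 (Real.abs_le_sqrt ?_)
        rw [le_div_iff₀ hmh]
        linarith)
    exact ⟨c, hc⟩
  choose v hv using hlim
  have hloc : ∀ x, Tendsto (fun n => G.localForm h (u n) (u n) x) l (𝓝 (G.localForm h v v x)) := by
    intro x
    simp only [localForm_eq, mul_gradForm]
    refine (tendsto_finsetSum _ fun y _ => ?_).add ?_
    · exact (((hv y).sub (hv x)).mul ((hv y).sub (hv x))).const_mul _
    · exact (((hv x).mul (hv x)).const_mul _).const_mul _
  obtain ⟨hvE, hv1⟩ := summable_and_tsum_le_of_tendsto (fun n x => localForm_self_nonneg hh (u n) x)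
    hu (fun n => (normWh_sq hh (u n)).symm.trans_le (h1 n)) hloc
  refine ⟨v, hvE, (normWh_sq hh v).trans_le hv1, ?_, ?_⟩
  · refine tendsto_tsum_of_weight (C := 1) hh₀ H hfin
      (fun n x => mul_nonneg (G.μ_pos x).le (sq_nonneg _))
      (fun n => ((hu n).summable_mul_sq hh).congr fun x => by ring) (fun n => ?_)
      fun x => ((hv x).pow 2).const_mul _
    have h1n := (normWh_sq hh (u n)).symm.trans_le (h1 n)
    refine (Summable.tsum_le_tsum (fun x => ?_) (((hu n).summable_mul_sq hh).congr fun x => by ring)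
      (hu n)).trans h1n
    exact (by ring : _ = _).trans_le (mul_sq_le_localForm h (u n) x)
  · refine tendsto_tsum_of_weight (C := 1 / (μ₀ * h₀)) hh₀ H hfin
      (fun n x => mul_nonneg (G.μ_pos x).le (by positivity))
      (fun n => (hu n).summable_mul_pow_four hμ₀ hμ hh₀ H) (fun n => ?_)
      fun x => ((hv x).pow 4).const_mul _
    refine (tsum_mul_pow_four_le hμ₀ hμ hh₀ H (hu n)).trans ?_
    have : G.normWh h (u n) ^ 4 ≤ 1 := by
      rw [show G.normWh h (u n) ^ 4 = (G.normWh h (u n) ^ 2) ^ 2 by ring]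
      exact pow_le_one₀ (sq_nonneg _) (h1 n)
    gcongr

end

end WeightedGraph

/-! ### The homogeneous parts of the energy and their bounds -/

namespace WeightedGraph

noncomputable section

open Filter Topology

variable {V : Type*} (G : WeightedGraph V)

/-- The second moment `∫ u² dμ`. -/
def moment2 (u : V → ℝ) : ℝ := ∑' x, G.μ x * u x ^ 2

/-- The fourth moment `∫ u⁴ dμ`. -/
def moment4 (u : V → ℝ) : ℝ := ∑' x, G.μ x * u x ^ 4

/-- Twice the quadratic part of the energy. -/
def quadPart (a lam : ℝ) (h u : V → ℝ) : ℝ := a * G.normWh h u ^ 2 - lam * G.moment2 u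

/-- Minus four times the quartic part of the energy. -/
def quartPart (b eta : ℝ) (h u : V → ℝ) : ℝ := eta * G.moment4 u - b * G.normWh h u ^ 4

variable {G}

lemma integral_abs_sq (u : V → ℝ) : (G.integral fun x => |u x| ^ 2) = G.moment2 u := by
  simp only [integral, moment2, sq_abs]

lemma abs_pow_four (r : ℝ) : |r| ^ 4 = r ^ 4 := by
  rw [show |r| ^ 4 = (|r| ^ 2) ^ 2 by ring, sq_abs]; ring

lemma integral_abs_pow_four (u : V → ℝ) : (G.integral fun x => |u x| ^ 4) = G.moment4 u := by
  simp only [integral, moment4, abs_pow_four]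

lemma J_eq (a b lam eta : ℝ) (h u : V → ℝ) :
    G.J a b lam eta h u = G.quadPart a lam h u / 2 - G.quartPart b eta h u / 4 := by
  rw [J, integral_abs_sq, integral_abs_pow_four, quadPart, quartPart]; ring

lemma derivJ_self {h : V → ℝ} (hh : ∀ x, 0 < h x) (a b lam eta : ℝ) (u : V → ℝ) :
    G.derivJ a b lam eta h u u = G.quadPart a lam h u - G.quartPart b eta h u := by
  have h1 : (G.integral fun x => G.gradForm u u x + h x * u x * u x) = G.normWh h u ^ 2 := by
    rw [normWh_sq hh]; rfl
  have h2 : (G.integral fun x => u x * u x) = G.moment2 u := by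
    simp only [integral, moment2, sq]
  have h3 : (G.integral fun x => |u x| ^ 2 * u x * u x) = G.moment4 u := by
    simp only [integral, moment4, sq_abs]
    exact tsum_congr fun x => by ring
  rw [derivJ, h1, h2, h3, quadPart, quartPart]; ring

lemma J_eq_of_quadPart_eq {a b lam eta : ℝ} {h u : V → ℝ}
    (hu : G.quadPart a lam h u = G.quartPart b eta h u) :
    G.J a b lam eta h u = G.quadPart a lam h u / 4 := by
  rw [J_eq, ← hu]; ring

lemma normWh_sq_smul {h : V → ℝ} (hh : ∀ x, 0 < h x) (c : ℝ) (u : V → ℝ) :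
    G.normWh h (c • u) ^ 2 = c ^ 2 * G.normWh h u ^ 2 := by
  rw [normWh_sq hh, normWh_sq hh, ← tsum_mul_left]
  refine tsum_congr fun x => ?_
  rw [← norm_sq_jet hh, ← norm_sq_jet hh, jet_smul, Pi.smul_apply, norm_smul, mul_pow,
    Real.norm_eq_abs, sq_abs]

lemma normWh_pow_four (h u : V → ℝ) : G.normWh h u ^ 4 = (G.normWh h u ^ 2) ^ 2 := by ring

lemma moment2_smul (c : ℝ) (u : V → ℝ) : G.moment2 (c • u) = c ^ 2 * G.moment2 u := by
  rw [moment2, moment2, ← tsum_mul_left]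
  exact tsum_congr fun x => by rw [Pi.smul_apply, smul_eq_mul]; ring

lemma moment4_smul (c : ℝ) (u : V → ℝ) : G.moment4 (c • u) = c ^ 4 * G.moment4 u := by
  rw [moment4, moment4, ← tsum_mul_left]
  exact tsum_congr fun x => by rw [Pi.smul_apply, smul_eq_mul]; ring

lemma quadPart_smul {h : V → ℝ} (hh : ∀ x, 0 < h x) (a lam c : ℝ) (u : V → ℝ) :
    G.quadPart a lam h (c • u) = c ^ 2 * G.quadPart a lam h u := by
  rw [quadPart, quadPart, normWh_sq_smul hh, moment2_smul]; ring

lemma quartPart_smul {h : V → ℝ} (hh : ∀ x, 0 < h x) (b eta c : ℝ) (u : V → ℝ) :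
    G.quartPart b eta h (c • u) = c ^ 4 * G.quartPart b eta h u := by
  rw [quartPart, quartPart, normWh_pow_four, normWh_sq_smul hh, moment4_smul]; ring

section Bounds

variable {μ₀ : ℝ} (hμ₀ : 0 < μ₀) (hμ : ∀ x, μ₀ ≤ G.μ x) {h : V → ℝ} {h₀ : ℝ} (hh₀ : 0 < h₀)
  (H : ∀ x, h₀ ≤ h x) {u : V → ℝ}

lemma moment2_nonneg (u : V → ℝ) : 0 ≤ G.moment2 u :=
  tsum_nonneg fun x => mul_nonneg (G.μ_pos x).le (sq_nonneg _)

lemma moment4_nonneg (u : V → ℝ) : 0 ≤ G.moment4 u :=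
  tsum_nonneg fun x => mul_nonneg (G.μ_pos x).le (by positivity)

include hh₀ H in
lemma moment2_pos (hu : G.FiniteEnergy h u) (hu0 : u ≠ 0) : 0 < G.moment2 u := by
  obtain ⟨x, hx⟩ := Function.ne_iff.1 hu0
  have hx : u x ≠ 0 := hx
  refine (hu.summable_sq hh₀ H).tsum_pos (fun x => mul_nonneg (G.μ_pos x).le (sq_nonneg _)) x ?_
  have := G.μ_pos x
  positivity

include hμ₀ hμ hh₀ H in
lemma moment4_pos (hu : G.FiniteEnergy h u) (hu0 : u ≠ 0) : 0 < G.moment4 u := by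
  obtain ⟨x, hx⟩ := Function.ne_iff.1 hu0
  have hx : u x ≠ 0 := hx
  refine (hu.summable_pow_four hμ₀ hμ hh₀ H).tsum_pos
    (fun x => mul_nonneg (G.μ_pos x).le (by positivity)) x ?_
  have := G.μ_pos x
  positivity

include hh₀ H in
lemma mul_moment2_le (hu : G.FiniteEnergy h u) : h₀ * G.moment2 u ≤ G.normWh h u ^ 2 := by
  rw [normWh_sq fun x => hh₀.trans_le (H x), moment2, ← tsum_mul_left]
  refine ((hu.summable_sq hh₀ H).mul_left _).tsum_le_tsum (fun x => ?_) hu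
  refine le_trans ?_ (mul_sq_le_localForm h u x)
  have := mul_le_mul_of_nonneg_right (H x) (mul_nonneg (G.μ_pos x).le (sq_nonneg (u x)))
  linarith

include hh₀ H in
lemma normWh_sq_pos (hu : G.FiniteEnergy h u) (hu0 : u ≠ 0) : 0 < G.normWh h u ^ 2 :=
  (mul_pos hh₀ (moment2_pos hh₀ H hu hu0)).trans_le (mul_moment2_le hh₀ H hu)

include hμ hh₀ H in
/-- The pointwise bound by the energy is strict on a graph with at least two vertices. -/
lemma sq_lt_normWh_sq [Nontrivial V] (hu : G.FiniteEnergy h u) (hu0 : u ≠ 0) (x : V) :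
    μ₀ * h₀ * u x ^ 2 < G.normWh h u ^ 2 := by
  have hh : ∀ x, 0 < h x := fun x => hh₀.trans_le (H x)
  have hloc : μ₀ * h₀ * u x ^ 2 ≤ G.μ x * (h x * u x ^ 2) := by
    have := hμ x
    have := H x
    have := (G.μ_pos x).le
    rw [mul_assoc]
    gcongr
  by_cases hx : u x = 0
  · rw [hx]
    simpa using normWh_sq_pos hh₀ H hu hu0
  obtain ⟨y, hy⟩ := G.connected.preconnected.exists_adj_of_nontrivial x
  -- For a neighbour `y` of `x`, the extra energy comes from the edge if `u y = 0`, and from the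
  -- potential term at `y` otherwise.
  by_cases hy0 : u y = 0
  · have h1 : G.μ x * (h x * u x ^ 2) < G.localForm h u u x := by
      rw [localForm_eq, mul_gradForm, ← sq]
      refine lt_add_of_pos_left _ (Finset.sum_pos' (fun z hz => ?_) ⟨y, mem_nbrs.2 hy, ?_⟩)
      · have := G.weight_pos x z (mem_nbrs.1 hz)
        have := mul_self_nonneg (u z - u x)
        positivity
      · have := G.weight_pos x y hy
        rw [hy0, zero_sub, neg_mul_neg]
        have := mul_self_pos.2 hx
        positivity
    rw [normWh_sq hh]
    exact hloc.trans_lt (h1.trans_le (hu.le_tsum x fun z _ => localForm_self_nonneg hh u z))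
  · classical
    have h1 : ∑ z ∈ {x, y}, G.localForm h u u z ≤ G.normWh h u ^ 2 := by
      rw [normWh_sq hh]
      exact hu.sum_le_tsum _ fun z _ => localForm_self_nonneg hh u z
    rw [Finset.sum_pair hy.ne] at h1
    have h2 := mul_sq_le_localForm (G := G) h u x
    have h3 := mul_sq_le_localForm (G := G) h u y
    have : 0 < G.μ y * (h y * u y ^ 2) := by
      have := G.μ_pos y
      have := hh y
      positivity
    linarith

include hμ₀ hμ hh₀ H in
lemma mul_moment4_lt [Nontrivial V] (hu : G.FiniteEnergy h u) (hu0 : u ≠ 0) :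
    μ₀ * h₀ * G.moment4 u < G.normWh h u ^ 2 * G.moment2 u := by
  obtain ⟨x, hx⟩ := Function.ne_iff.1 hu0
  have hx : u x ≠ 0 := hx
  rw [moment4, moment2, ← tsum_mul_left, ← tsum_mul_left]
  refine ((hu.summable_pow_four hμ₀ hμ hh₀ H).mul_left _).tsum_lt_tsum (i := x) (fun y => ?_) ?_
    ((hu.summable_sq hh₀ H).mul_left _)
  · have := mul_le_mul_of_nonneg_right (sq_lt_normWh_sq hμ hh₀ H hu hu0 y).le
      (mul_nonneg (G.μ_pos y).le (sq_nonneg (u y)))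
    linarith
  · have h1 : 0 < G.μ x * u x ^ 2 := by
      have := G.μ_pos x
      positivity
    have := mul_lt_mul_of_pos_right (sq_lt_normWh_sq hμ hh₀ H hu hu0 x) h1
    linarith

include hμ₀ hμ hh₀ H in
lemma lambda1_mul_moment2_le (hu : G.FiniteEnergy h u) :
    G.lambda1 h * G.moment2 u ≤ G.normWh h u ^ 2 := by
  by_cases hu0 : u = 0
  · subst hu0
    simpa [moment2] using sq_nonneg (G.normWh h 0)
  rw [← le_div_iff₀ (moment2_pos hh₀ H hu hu0)]
  refine csInf_le ⟨0, ?_⟩ ⟨u, (memWh_iff hμ₀ hμ hh₀ H).2 hu, hu0, by rw [integral_abs_sq]⟩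
  rintro r ⟨v, -, -, rfl⟩
  rw [integral_abs_sq]
  exact div_nonneg (sq_nonneg _) (moment2_nonneg v)

lemma delta_ne_zero (z : V) : (delta z : V → ℝ) ≠ 0 := fun e => by
  simpa [delta_self] using congrFun e z

include hμ₀ hμ hh₀ H in
lemma le_lambda1 [Nonempty V] : h₀ ≤ G.lambda1 h := by
  obtain ⟨z⟩ := ‹Nonempty V›
  refine le_csInf ⟨_, delta z, (memWh_iff hμ₀ hμ hh₀ H).2 (finiteEnergy_delta h z),
    delta_ne_zero z, rfl⟩ ?_
  rintro r ⟨v, hv, hv0, rfl⟩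
  rw [memWh_iff hμ₀ hμ hh₀ H] at hv
  rw [integral_abs_sq, le_div_iff₀ (moment2_pos hh₀ H hv hv0)]
  exact mul_moment2_le hh₀ H hv

variable {b : ℝ} (hb : 0 ≤ b)

include hμ₀ hμ hh₀ H hb in
lemma eta0_mul_moment4_le (hu : G.FiniteEnergy h u) (hu0 : u ≠ 0) :
    G.eta0 b h * G.moment4 u ≤ b * G.normWh h u ^ 4 := by
  rw [← le_div_iff₀ (moment4_pos hμ₀ hμ hh₀ H hu hu0)]
  refine csInf_le ⟨0, ?_⟩ ⟨u, (memWh_iff hμ₀ hμ hh₀ H).2 hu, hu0, by rw [integral_abs_pow_four]⟩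
  rintro r ⟨v, -, -, rfl⟩
  rw [integral_abs_pow_four]
  exact div_nonneg (mul_nonneg hb (by positivity)) (moment4_nonneg v)

include hb in
lemma eta0_nonneg : 0 ≤ G.eta0 b h := by
  refine Real.sInf_nonneg ?_
  rintro r ⟨v, -, -, rfl⟩
  rw [integral_abs_pow_four]
  exact div_nonneg (mul_nonneg hb (by positivity)) (moment4_nonneg v)

include hμ₀ hμ hh₀ H in
lemma exists_quartPart_pos [Nonempty V] {eta : ℝ} (heta : G.eta0 b h < eta) :
    ∃ u, G.FiniteEnergy h u ∧ u ≠ 0 ∧ 0 < G.quartPart b eta h u := by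
  obtain ⟨z⟩ := ‹Nonempty V›
  obtain ⟨r, ⟨u, hu, hu0, rfl⟩, hlt⟩ := exists_lt_of_csInf_lt (by
    exact ⟨_, delta z, (memWh_iff hμ₀ hμ hh₀ H).2 (finiteEnergy_delta h z),
      delta_ne_zero z, rfl⟩) heta
  rw [memWh_iff hμ₀ hμ hh₀ H] at hu
  rw [integral_abs_pow_four, div_lt_iff₀ (moment4_pos hμ₀ hμ hh₀ H hu hu0)] at hlt
  exact ⟨u, hu, hu0, sub_pos.2 hlt⟩

variable {a lam : ℝ} (ha : 0 < a)

include hμ₀ hμ hh₀ H in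
-- Coercivity. The absolute value serves both signs of `lam`, since the second moment is bounded
-- below only by 0.
lemma mul_normWh_sq_le_quadPart [Nonempty V] (hu : G.FiniteEnergy h u) :
    (a - |lam| / G.lambda1 h) * G.normWh h u ^ 2 ≤ G.quadPart a lam h u := by
  have hl : 0 < G.lambda1 h := hh₀.trans_le (le_lambda1 hμ₀ hμ hh₀ H)
  have h1 : G.moment2 u ≤ G.normWh h u ^ 2 / G.lambda1 h := by
    rw [le_div_iff₀ hl, mul_comm]
    exact lambda1_mul_moment2_le hμ₀ hμ hh₀ H hu
  have h2 : lam * G.moment2 u ≤ |lam| * (G.normWh h u ^ 2 / G.lambda1 h) :=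
    mul_le_mul (le_abs_self lam) h1 (moment2_nonneg u) (abs_nonneg lam)
  rw [quadPart]
  calc _ = a * G.normWh h u ^ 2 - |lam| * (G.normWh h u ^ 2 / G.lambda1 h) := by ring
    _ ≤ _ := by linarith

include hμ₀ hμ hh₀ H ha in
lemma quadPart_pos [Nonempty V] (hlam : lam < a * G.lambda1 h) (hu : G.FiniteEnergy h u)
    (hu0 : u ≠ 0) : 0 < G.quadPart a lam h u := by
  have h1 := lambda1_mul_moment2_le hμ₀ hμ hh₀ H hu
  have h2 := mul_lt_mul_of_pos_right hlam (moment2_pos hh₀ H hu hu0)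
  have h3 := mul_le_mul_of_nonneg_left h1 ha.le
  rw [quadPart]
  linarith

end Bounds

end

end WeightedGraph

/-! ### Nonexistence and the variational problem -/

namespace WeightedGraph

noncomputable section

open Filter Topology

variable {V : Type*} {G : WeightedGraph V}

section Variational

variable {μ₀ : ℝ} (hμ₀ : 0 < μ₀) (hμ : ∀ x, μ₀ ≤ G.μ x) {h : V → ℝ} {h₀ : ℝ} (hh₀ : 0 < h₀)
  (H : ∀ x, h₀ ≤ h x) {a b lam eta : ℝ} (ha : 0 < a) (hb : 0 ≤ b)

include hμ₀ hμ hh₀ H ha hb in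
-- Dividing by `c = a + b ‖u‖² > 0` turns the equation into a linear one with right-hand side `g`,
-- which is square summable because `u` is bounded; testing it with `u` gives the identity.
lemma IsNontrivialSolution.quadPart_eq {u : V → ℝ}
    (hu : G.IsNontrivialSolution a b lam eta h u) :
    G.quadPart a lam h u = G.quartPart b eta h u := by
  obtain ⟨hmem, -, hsol⟩ := hu
  rw [memWh_iff hμ₀ hμ hh₀ H] at hmem
  set c := a + b * G.normWh h u ^ 2 with hc
  have hcpos : 0 < c := by positivity
  have hs2 := hmem.summable_sq hh₀ H
  have hs4 := hmem.summable_pow_four hμ₀ hμ hh₀ H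
  have hbd : ∀ x, u x ^ 2 ≤ G.normWh h u ^ 2 / (μ₀ * h₀) := fun x => by
    rw [le_div_iff₀ (mul_pos hμ₀ hh₀), mul_comm]
    exact sq_le_normWh_sq hμ hh₀ H hmem x
  have hg : Summable fun x => G.μ x * ((lam * u x + eta * u x ^ 3) / c) ^ 2 := by
    refine (hs2.mul_left (((|lam| + |eta| * (G.normWh h u ^ 2 / (μ₀ * h₀))) / c) ^ 2)).of_nonneg_of_le
      (fun x => mul_nonneg (G.μ_pos x).le (sq_nonneg _)) fun x => ?_
    have h1 : |(lam + eta * u x ^ 2) / c| ≤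
        (|lam| + |eta| * (G.normWh h u ^ 2 / (μ₀ * h₀))) / c := by
      rw [abs_div, abs_of_pos hcpos]
      gcongr
      refine (abs_add_le _ _).trans ?_
      rw [abs_mul, abs_of_nonneg (sq_nonneg (u x))]
      have := hbd x
      gcongr
    have h2 := mul_le_mul_of_nonneg_right (sq_le_sq.2 (h1.trans (le_abs_self _)))
      (mul_nonneg (G.μ_pos x).le (sq_nonneg (u x)))
    exact (by ring : _ = _).trans_le h2
  have key := normWh_sq_of_solution hμ₀ hμ hh₀ H hmem hg fun x => by
    rw [eq_div_iff hcpos.ne', mul_comm, hsol x, sq_abs]; ring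
  have hsum : ∑' x, G.μ x * ((lam * u x + eta * u x ^ 3) / c * u x) =
      (lam * G.moment2 u + eta * G.moment4 u) / c := by
    rw [moment2, moment4, ← tsum_mul_left, ← tsum_mul_left,
      ← (hs2.mul_left lam).tsum_add (hs4.mul_left eta), ← tsum_div_const]
    exact tsum_congr fun x => by ring
  rw [hsum, eq_div_iff hcpos.ne', hc] at key
  rw [quadPart, quartPart]
  linarith

include hμ₀ hμ hh₀ H ha hb in
lemma not_exists_isNontrivialSolution [Nonempty V] (hlam : lam < a * G.lambda1 h)
    (heta : eta ≤ G.eta0 b h) : ¬ ∃ u, G.IsNontrivialSolution a b lam eta h u := by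
  rintro ⟨u, hu⟩
  have h1 := hu.quadPart_eq hμ₀ hμ hh₀ H ha hb
  obtain ⟨hmem, hu0, -⟩ := hu
  rw [memWh_iff hμ₀ hμ hh₀ H] at hmem
  have h2 := quadPart_pos hμ₀ hμ hh₀ H ha hlam hmem hu0
  have h3 := eta0_mul_moment4_le hμ₀ hμ hh₀ H hb hmem hu0
  have h4 := mul_le_mul_of_nonneg_right heta (moment4_nonneg (G := G) u)
  rw [h1, quartPart] at h2
  linarith

include hμ₀ hμ hh₀ H ha hb in
/-- The quotient of the quartic part by the square of the quadratic part attains its maximum. -/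
lemma exists_maximizer [Nonempty V] (hfin : ∀ M, {x | h x ≤ M}.Finite)
    (hlam : |lam| < a * G.lambda1 h) (heta : G.eta0 b h < eta) :
    ∃ u, G.FiniteEnergy h u ∧ u ≠ 0 ∧ 0 < G.quartPart b eta h u ∧
      ∀ w, G.FiniteEnergy h w →
        G.quartPart b eta h w * G.quadPart a lam h u ^ 2 ≤
          G.quartPart b eta h u * G.quadPart a lam h w ^ 2 := by
  have hh : ∀ x, 0 < h x := fun x => hh₀.trans_le (H x)
  have hl : 0 < G.lambda1 h := hh₀.trans_le (le_lambda1 hμ₀ hμ hh₀ H)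
  have hlam' : lam < a * G.lambda1 h := (le_abs_self lam).trans_lt hlam
  have hc : 0 < a - |lam| / G.lambda1 h := by rwa [sub_pos, div_lt_iff₀ hl]
  have heta0 : 0 < eta := (eta0_nonneg hb).trans_lt heta
  set c := a - |lam| / G.lambda1 h with hcdef
  -- The quotient has degree 0, so it may be studied on the unit sphere.
  have hnormalize : ∀ w, G.FiniteEnergy h w → w ≠ 0 → ∃ v, G.FiniteEnergy h v ∧
      G.normWh h v ^ 2 = 1 ∧ G.quartPart b eta h v / G.quadPart a lam h v ^ 2 =
        G.quartPart b eta h w / G.quadPart a lam h w ^ 2 := by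
    intro w hw hw0
    have hN := normWh_sq_pos hh₀ H hw hw0
    have hN0 : G.normWh h w ≠ 0 := fun e => by simp [e] at hN
    refine ⟨(G.normWh h w)⁻¹ • w, hw.smul hh _, ?_, ?_⟩
    · rw [normWh_sq_smul hh]
      field_simp
    · rw [quartPart_smul hh, quadPart_smul hh, mul_pow, ← pow_mul]
      exact mul_div_mul_left _ _ (pow_ne_zero _ (inv_ne_zero hN0))
  let S : Set ℝ := {r | ∃ v, G.FiniteEnergy h v ∧ G.normWh h v ^ 2 = 1 ∧
    r = G.quartPart b eta h v / G.quadPart a lam h v ^ 2}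
  have hlow : ∀ v, G.FiniteEnergy h v → G.normWh h v ^ 2 = 1 → c ≤ G.quadPart a lam h v := by
    intro v hv hv1
    have h1 := mul_normWh_sq_le_quadPart (a := a) (lam := lam) hμ₀ hμ hh₀ H hv
    rwa [hv1, mul_one] at h1
  have hbdd : BddAbove S := by
    refine ⟨eta * (1 / (h₀ * (μ₀ * h₀))) / c ^ 2, ?_⟩
    rintro r ⟨v, hv, hv1, rfl⟩
    have h1 := hlow v hv hv1
    have h2 := tsum_mul_pow_four_le hμ₀ hμ hh₀ H hv
    have h3 : h₀ * G.moment4 v ≤ ∑' x, h x * (G.μ x * v x ^ 4) := by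
      rw [moment4, ← tsum_mul_left]
      refine ((hv.summable_pow_four hμ₀ hμ hh₀ H).mul_left _).tsum_le_tsum (fun x => ?_)
        (hv.summable_mul_pow_four hμ₀ hμ hh₀ H)
      exact mul_le_mul_of_nonneg_right (H x) (mul_nonneg (G.μ_pos x).le (by positivity))
    have h4 : G.moment4 v ≤ 1 / (h₀ * (μ₀ * h₀)) := by
      rw [le_div_iff₀ (by positivity)]
      rw [normWh_pow_four, hv1, one_pow, le_div_iff₀ (by positivity)] at h2
      have := mul_le_mul_of_nonneg_right h3 (mul_pos hμ₀ hh₀).le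
      linarith
    have h5 : G.quartPart b eta h v ≤ eta * (1 / (h₀ * (μ₀ * h₀))) := by
      have := mul_le_mul_of_nonneg_left h4 heta0.le
      have : 0 ≤ b * G.normWh h v ^ 4 := by positivity
      rw [quartPart]
      linarith
    exact div_le_div₀ (by positivity) h5 (by positivity) (by gcongr)
  obtain ⟨w₀, hw₀, hw₀0, hw₀Q⟩ := exists_quartPart_pos hμ₀ hμ hh₀ H heta
  have hw₀P := quadPart_pos hμ₀ hμ hh₀ H ha hlam' hw₀ hw₀0
  obtain ⟨v₀, hv₀, hv₀1, hv₀r⟩ := hnormalize w₀ hw₀ hw₀0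
  have hne : S.Nonempty := ⟨_, v₀, hv₀, hv₀1, rfl⟩
  have hpos : 0 < sSup S := by
    refine lt_of_lt_of_le ?_ (le_csSup hbdd ⟨v₀, hv₀, hv₀1, rfl⟩)
    rw [hv₀r]
    positivity
  obtain ⟨r, -, hr, hrS⟩ := exists_seq_tendsto_sSup hne hbdd
  choose u hu hu1 hur using hrS
  obtain ⟨v, hv, hv1, hv2, hv4⟩ := exists_limit_of_bounded hμ₀ hμ hh₀ H hfin hu
    (fun n => (hu1 n).le) (hyperfilter ℕ)
  have hr' : Tendsto r (hyperfilter ℕ : Filter ℕ) (𝓝 (sSup S)) :=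
    hr.mono_left Nat.hyperfilter_le_atTop
  -- The constants `a` and `b` in the limits come from `‖u n‖ = 1`; the limit `v` itself only
  -- satisfies `‖v‖ ≤ 1`.
  have hP : Tendsto (fun n => G.quadPart a lam h (u n)) (hyperfilter ℕ : Filter ℕ)
      (𝓝 (a - lam * G.moment2 v)) := by
    simp only [quadPart, hu1, mul_one]
    exact tendsto_const_nhds.sub (hv2.const_mul lam)
  have hQ : Tendsto (fun n => G.quartPart b eta h (u n)) (hyperfilter ℕ : Filter ℕ)
      (𝓝 (eta * G.moment4 v - b)) := by
    simp only [quartPart, normWh_pow_four, hu1, mul_one, one_pow]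
    exact (hv4.const_mul eta).sub tendsto_const_nhds
  have hp : 0 < a - lam * G.moment2 v :=
    hc.trans_le (ge_of_tendsto' hP fun n => hlow _ (hu n) (hu1 n))
  have hs : sSup S = (eta * G.moment4 v - b) / (a - lam * G.moment2 v) ^ 2 :=
    tendsto_nhds_unique hr' (by
      rw [funext hur]
      exact hQ.div (hP.pow 2) (by positivity))
  have hq : 0 < eta * G.moment4 v - b := by
    rw [hs] at hpos
    exact (div_pos_iff_of_pos_right (by positivity)).1 hpos
  -- Loss of norm is harmless: `b ≥ 0` and `a > 0` make `Q v` at least, and `P v` at most, the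
  -- corresponding limit.
  have hqle : eta * G.moment4 v - b ≤ G.quartPart b eta h v := by
    have h1 : G.normWh h v ^ 4 ≤ 1 := by
      rw [normWh_pow_four]
      exact pow_le_one₀ (sq_nonneg _) hv1
    have := mul_le_mul_of_nonneg_left h1 hb
    rw [quartPart]
    linarith
  have hple : G.quadPart a lam h v ≤ a - lam * G.moment2 v := by
    have := mul_le_mul_of_nonneg_left hv1 ha.le
    rw [quadPart]
    linarith
  have hv0 : v ≠ 0 := by
    rintro rfl
    have h1 : G.moment4 (0 : V → ℝ) = 0 := by simp [moment4]
    rw [h1] at hq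
    linarith
  have hvP := quadPart_pos hμ₀ hμ hh₀ H ha hlam' hv hv0
  have hvQ := hq.trans_le hqle
  refine ⟨v, hv, hv0, hvQ, fun w hw => ?_⟩
  by_cases hw0 : w = 0
  · subst hw0
    rw [← zero_smul ℝ v, quartPart_smul hh, quadPart_smul hh]
    simp
  have hwP := quadPart_pos hμ₀ hμ hh₀ H ha hlam' hw hw0
  obtain ⟨w', hw', hw'1, hw'r⟩ := hnormalize w hw hw0
  have h1 : G.quartPart b eta h w / G.quadPart a lam h w ^ 2 ≤ sSup S :=
    hw'r ▸ le_csSup hbdd ⟨w', hw', hw'1, rfl⟩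
  have h2 : sSup S ≤ G.quartPart b eta h v / G.quadPart a lam h v ^ 2 := by
    rw [hs]
    exact div_le_div₀ hvQ.le hqle (by positivity) (by gcongr)
  exact (div_le_div_iff₀ (by positivity) (by positivity)).1 (h1.trans h2)

include hμ₀ hμ hh₀ H ha hb in
/-- The maximizer, scaled onto the Nehari set. -/
lemma exists_maximizer_nehari [Nonempty V] (hfin : ∀ M, {x | h x ≤ M}.Finite)
    (hlam : |lam| < a * G.lambda1 h) (heta : G.eta0 b h < eta) :
    ∃ u, G.FiniteEnergy h u ∧ u ≠ 0 ∧ G.quadPart a lam h u = G.quartPart b eta h u ∧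
      ∀ w, G.FiniteEnergy h w →
        G.quartPart b eta h w * G.quadPart a lam h u ≤ G.quadPart a lam h w ^ 2 := by
  have hh : ∀ x, 0 < h x := fun x => hh₀.trans_le (H x)
  obtain ⟨v, hv, hv0, hvQ, hmax⟩ := exists_maximizer hμ₀ hμ hh₀ H ha hb hfin hlam heta
  have hvP := quadPart_pos hμ₀ hμ hh₀ H ha ((le_abs_self lam).trans_lt hlam) hv hv0
  -- This `t` solves `t² P v = t⁴ Q v`.
  set t := √(G.quadPart a lam h v / G.quartPart b eta h v) with ht
  have ht0 : 0 < t := Real.sqrt_pos.2 (div_pos hvP hvQ)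
  have ht2 : t ^ 2 = G.quadPart a lam h v / G.quartPart b eta h v :=
    Real.sq_sqrt (div_pos hvP hvQ).le
  have hP : G.quadPart a lam h (t • v) = G.quadPart a lam h v ^ 2 / G.quartPart b eta h v := by
    rw [quadPart_smul hh, ht2]; ring
  refine ⟨t • v, hv.smul hh t, smul_ne_zero ht0.ne' hv0, ?_, fun w hw => ?_⟩
  · rw [hP, quartPart_smul hh, show t ^ 4 = (t ^ 2) ^ 2 by ring, ht2]
    field_simp
  · rw [hP, ← mul_div_assoc, div_le_iff₀ hvQ, mul_comm (_ ^ 2)]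
    exact hmax w hw

/-! ### Euler–Lagrange equation and lower bound for the norm -/

lemma tsum_add_smul_delta (f : ℝ → ℝ) {u : V → ℝ} (hs : Summable fun x => G.μ x * f (u x))
    (z : V) (t : ℝ) : ∑' x, G.μ x * f ((u + t • delta z) x) =
      ∑' x, G.μ x * f (u x) + G.μ z * (f (u z + t) - f (u z)) := by
  have h1 := hasSum_single (f := fun x => G.μ x * (f ((u + t • delta z) x) - f (u x))) z
    fun x hx => by simp [delta_of_ne hx]
  have h2 := (hs.hasSum.add h1).tsum_eq
  simp only [Pi.add_apply, Pi.smul_apply, delta_self, smul_eq_mul, mul_one] at h2 ⊢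
  rw [← h2]
  exact tsum_congr fun x => by ring

lemma normWh_sq_add_smul_delta (hh : ∀ x, 0 < h x) {u : V → ℝ} (hu : G.FiniteEnergy h u)
    (z : V) (t : ℝ) : G.normWh h (u + t • delta z) ^ 2 = G.normWh h u ^ 2 +
      2 * t * (G.μ z * (-G.laplacian u z + h z * u z)) + t ^ 2 * G.normWh h (delta z) ^ 2 := by
  have h1 := ((hu.hasSum.add ((hasSum_localForm_delta (G := G) h u z).mul_left (2 * t))).add
    ((G.finiteEnergy_delta h z).hasSum.mul_left (t ^ 2))).tsum_eq
  rw [normWh_sq hh, normWh_sq hh, normWh_sq hh, ← h1]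
  refine tsum_congr fun x => ?_
  simp only [← inner_jet hh, jet_add, jet_smul, Pi.add_apply, Pi.smul_apply]
  rw [real_inner_add_add_self, real_inner_smul_right, real_inner_smul_left, real_inner_smul_right]
  ring

include hμ₀ hμ hh₀ H in
/-- The Euler--Lagrange equation of the maximizer on the Nehari set. -/
lemma equation_of_maximizer {u : V → ℝ} (hu : G.FiniteEnergy h u)
    (hP : 0 < G.quadPart a lam h u) (hPQ : G.quadPart a lam h u = G.quartPart b eta h u)
    (hmax : ∀ w, G.FiniteEnergy h w →
      G.quartPart b eta h w * G.quadPart a lam h u ≤ G.quadPart a lam h w ^ 2) (z : V) :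
    (a + b * G.normWh h u ^ 2) * (-G.laplacian u z + h z * u z)
      = lam * u z + eta * |u z| ^ 2 * u z := by
  have hh : ∀ x, 0 < h x := fun x => hh₀.trans_le (H x)
  set p := G.quadPart a lam h u with hp
  set n := G.μ z * (-G.laplacian u z + h z * u z) with hn
  have hN : HasDerivAt (fun t : ℝ => G.normWh h (u + t • delta z) ^ 2) (2 * n) 0 := by
    simp only [normWh_sq_add_smul_delta hh hu]
    have h1 := ((((hasDerivAt_id (0 : ℝ)).const_mul 2).mul_const n).const_add
      (G.normWh h u ^ 2)).add (((hasDerivAt_id (0 : ℝ)).pow 2).mul_const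
        (G.normWh h (delta z) ^ 2))
    simpa [Pi.add_def] using h1
  have hA : HasDerivAt (fun t : ℝ => G.moment2 (u + t • delta z)) (2 * G.μ z * u z) 0 := by
    have hs := hu.summable_sq hh₀ H
    simp only [moment2, tsum_add_smul_delta (fun s => s ^ 2) hs]
    have h1 := ((((((hasDerivAt_id (0 : ℝ)).const_add (u z)).pow 2).sub_const
      (u z ^ 2)).const_mul (G.μ z)).const_add (∑' x, G.μ x * u x ^ 2))
    exact h1.congr_deriv (by simp; ring)
  have hB : HasDerivAt (fun t : ℝ => G.moment4 (u + t • delta z)) (4 * G.μ z * u z ^ 3) 0 := by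
    have hs := hu.summable_pow_four hμ₀ hμ hh₀ H
    simp only [moment4, tsum_add_smul_delta (fun s => s ^ 4) hs]
    have h1 := ((((((hasDerivAt_id (0 : ℝ)).const_add (u z)).pow 4).sub_const
      (u z ^ 4)).const_mul (G.μ z)).const_add (∑' x, G.μ x * u x ^ 4))
    exact h1.congr_deriv (by simp; ring)
  have hu0 : u + (0 : ℝ) • delta z = u := by simp
  have hPd : HasDerivAt (fun t : ℝ => G.quadPart a lam h (u + t • delta z))
      (a * (2 * n) - lam * (2 * G.μ z * u z)) 0 := (hN.const_mul a).sub (hA.const_mul lam)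
  have hQd : HasDerivAt (fun t : ℝ => G.quartPart b eta h (u + t • delta z))
      (eta * (4 * G.μ z * u z ^ 3) - b * (2 * G.normWh h u ^ 2 * (2 * n))) 0 := by
    simp only [quartPart, normWh_pow_four]
    have h1 := (hB.const_mul eta).sub ((hN.pow 2).const_mul b)
    simpa [hu0, Pi.sub_def] using h1
  have hF := (hPd.pow 2).sub (hQd.mul_const p)
  -- The function `P² - p Q` is nonnegative along the line and equals `p² - p p = 0` at `t = 0`, so
  -- no Lagrange multiplier appears.
  have hmin : IsLocalMin ((fun t : ℝ => G.quadPart a lam h (u + t • delta z)) ^ 2 -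
      fun t : ℝ => G.quartPart b eta h (u + t • delta z) * p) 0 := by
    refine Filter.Eventually.of_forall fun t => ?_
    have h1 := hmax _ (hu.add hh ((G.finiteEnergy_delta h z).smul hh t))
    simp only [Pi.sub_apply, Pi.pow_apply, hu0, ← hp, ← hPQ]
    linarith [sq p]
  have h0 := hmin.hasDerivAt_eq_zero hF
  simp only [hu0, ← hp] at h0
  -- The derivative `2 p P' - p Q'` at 0 is `4 p μ(z)` times the residual of the equation.
  have h1 : (4 * p * G.μ z) * ((a + b * G.normWh h u ^ 2) * (-G.laplacian u z + h z * u z) -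
      (lam * u z + eta * u z ^ 3)) = 0 := by
    rw [← h0, hn]
    norm_num
    ring
  have h2 : 4 * p * G.μ z ≠ 0 := (mul_pos (mul_pos four_pos hP) (G.μ_pos z)).ne'
  rw [sq_abs]
  linarith [(mul_eq_zero.1 h1).resolve_left h2]

include hμ₀ hμ hh₀ H ha hb in
-- With `N = ‖u‖²`, `A = ∫ u²` and `m = μ₀ h₀`, dropping `b N²` and using `m ∫ u⁴ < N A` gives `a N
-- m < A (lam m + eta N)`. Then `λ₁* A ≤ N`, and `N` cancels.
lemma lt_normWh_sq_of_quadPart_eq [Nontrivial V] (heta : 0 < eta)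
    (hlam : lam < a * G.lambda1 h) {u : V → ℝ} (hu : G.FiniteEnergy h u) (hu0 : u ≠ 0)
    (hPQ : G.quadPart a lam h u = G.quartPart b eta h u) :
    (a - lam / G.lambda1 h) / eta * (μ₀ * h₀ ^ 2) < G.normWh h u ^ 2 := by
  have hle := le_lambda1 hμ₀ hμ hh₀ H
  have hl : 0 < G.lambda1 h := hh₀.trans_le hle
  have hN := normWh_sq_pos hh₀ H hu hu0
  have hA := moment2_pos hh₀ H hu hu0
  have hAN := lambda1_mul_moment2_le hμ₀ hμ hh₀ H hu
  have hB := mul_moment4_lt hμ₀ hμ hh₀ H hu hu0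
  rw [quadPart, quartPart] at hPQ
  have hm : 0 < μ₀ * h₀ := mul_pos hμ₀ hh₀
  have hd : 0 < a - lam / G.lambda1 h := by rwa [sub_pos, div_lt_iff₀ hl]
  set N := G.normWh h u ^ 2 with hNdef
  set A := G.moment2 u
  have h1 : a * N * (μ₀ * h₀) < A * (lam * (μ₀ * h₀) + eta * N) := by
    have h2 := mul_lt_mul_of_pos_left hB heta
    have h3 : 0 ≤ b * G.normWh h u ^ 4 * (μ₀ * h₀) := by positivity
    have h4 := congrArg (fun r => r * (μ₀ * h₀)) hPQ
    beta_reduce at h4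
    linarith
  -- Since `lam` may be negative, the sign of this factor is read off from `h1`.
  have h5 : 0 < lam * (μ₀ * h₀) + eta * N :=
    pos_of_mul_pos_right (lt_trans (by positivity) h1) hA.le
  have h6 : N * (a * G.lambda1 h * (μ₀ * h₀)) < N * (lam * (μ₀ * h₀) + eta * N) := by
    have h7 := mul_le_mul_of_nonneg_right hAN h5.le
    have h8 := mul_lt_mul_of_pos_left h1 hl
    linarith
  have h9 := lt_of_mul_lt_mul_left h6 hN.le
  -- Replacing `λ₁*` by its lower bound `h₀` yields the second factor `h₀`.
  have h10 : (a - lam / G.lambda1 h) * h₀ * (μ₀ * h₀) ≤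
      (a - lam / G.lambda1 h) * G.lambda1 h * (μ₀ * h₀) := by gcongr
  have h11 : (a - lam / G.lambda1 h) * G.lambda1 h = a * G.lambda1 h - lam := by
    field_simp
  rw [h11] at h10
  rw [div_mul_eq_mul_div, div_lt_iff₀ heta]
  linarith

end Variational

end

end WeightedGraph

/-! ### The main theorem -/

theorem theorem1p2 {V : Type*} [Nontrivial V] (G : WeightedGraph V)
    (μ₀ : ℝ) (hμ₀ : 0 < μ₀) (hμ : ∀ x, μ₀ ≤ G.μ x)
    (a b lam eta : ℝ) (ha : 0 < a) (hb : 0 ≤ b)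
    (h : V → ℝ) (h₀ : ℝ) (hh₀ : 0 < h₀) (H₁ : ∀ x, h₀ ≤ h x)
    (H₂ : ∃ x₀ : V, Filter.Tendsto h
      (Filter.comap (fun x => G.graph.dist x x₀) Filter.atTop) Filter.atTop) :
    (lam < a * G.lambda1 h → eta ≤ G.eta0 b h →
      ¬ ∃ u, G.IsNontrivialSolution a b lam eta h u) ∧
    (|lam| < a * G.lambda1 h → G.eta0 b h < eta →
      ∃ u, G.IsLeastEnergySolution a b lam eta h u ∧
        (u ∈ G.nehari a b lam eta h ∧
          ∀ v ∈ G.nehari a b lam eta h, G.J a b lam eta h u ≤ G.J a b lam eta h v) ∧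
        √((a - lam / G.lambda1 h) / eta * (μ₀ * h₀ ^ 2)) < G.normWh h u ∧
        1 / 4 * (a - |lam| / G.lambda1 h) *
          ((a - lam / G.lambda1 h) / eta * (μ₀ * h₀ ^ 2)) < G.J a b lam eta h u) := by
  have : Nonempty V := ⟨(exists_pair_ne V).choose⟩
  obtain ⟨x₀, hx₀⟩ := H₂
  refine ⟨WeightedGraph.not_exists_isNontrivialSolution hμ₀ hμ hh₀ H₁ ha hb, fun hlam heta => ?_⟩
  have hl : 0 < G.lambda1 h := hh₀.trans_le (WeightedGraph.le_lambda1 hμ₀ hμ hh₀ H₁)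
  have hlam' : lam < a * G.lambda1 h := (le_abs_self lam).trans_lt hlam
  have hh : ∀ x, 0 < h x := fun x => hh₀.trans_le (H₁ x)
  have heta0 : 0 < eta := (WeightedGraph.eta0_nonneg hb).trans_lt heta
  obtain ⟨u, hu, hu0, hPQ, hmax⟩ := WeightedGraph.exists_maximizer_nehari hμ₀ hμ hh₀ H₁ ha hb
    (WeightedGraph.finite_le_of_tendsto hx₀) hlam heta
  have hP := WeightedGraph.quadPart_pos hμ₀ hμ hh₀ H₁ ha hlam' hu hu0
  have hmem := (WeightedGraph.memWh_iff hμ₀ hμ hh₀ H₁).2 hu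
  have hJ := WeightedGraph.J_eq_of_quadPart_eq hPQ
  -- If `P v = Q v`, maximality reads `P v * P u ≤ (P v)²`, hence `P u ≤ P v`, and `J = P/4` at
  -- both. This covers solutions and the Nehari set alike.
  have hmin : ∀ v, G.MemWh h v → v ≠ 0 →
      G.quadPart a lam h v = G.quartPart b eta h v →
      G.J a b lam eta h u ≤ G.J a b lam eta h v := by
    intro v hv hv0 hvPQ
    rw [WeightedGraph.memWh_iff hμ₀ hμ hh₀ H₁] at hv
    have hvP := WeightedGraph.quadPart_pos hμ₀ hμ hh₀ H₁ ha hlam' hv hv0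
    have h1 := hmax v hv
    rw [← hvPQ, sq] at h1
    rw [hJ, WeightedGraph.J_eq_of_quadPart_eq hvPQ]
    linarith [le_of_mul_le_mul_left h1 hvP]
  have hN := WeightedGraph.lt_normWh_sq_of_quadPart_eq hμ₀ hμ hh₀ H₁ ha hb heta0 hlam' hu hu0 hPQ
  have hd : 0 < a - lam / G.lambda1 h := by rwa [sub_pos, div_lt_iff₀ hl]
  have hc : 0 < a - |lam| / G.lambda1 h := by rwa [sub_pos, div_lt_iff₀ hl]
  refine ⟨u, ⟨⟨hmem, hu0, WeightedGraph.equation_of_maximizer hμ₀ hμ hh₀ H₁ hu hP hPQ hmax⟩, fun v hv =>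
    hmin v hv.1 hv.2.1 (hv.quadPart_eq hμ₀ hμ hh₀ H₁ ha hb)⟩,
    ⟨⟨hmem, hu0, ?_⟩, fun v hv => hmin v hv.1 hv.2.1 ?_⟩, ?_, ?_⟩
  · rw [WeightedGraph.derivJ_self hh, hPQ, sub_self]
  · have h1 := hv.2.2
    rwa [WeightedGraph.derivJ_self hh, sub_eq_zero] at h1
  · rw [← Real.sqrt_sq (WeightedGraph.normWh_nonneg h u)]
    exact Real.sqrt_lt_sqrt (by positivity) hN
  · have h1 := WeightedGraph.mul_normWh_sq_le_quadPart (a := a) (lam := lam) hμ₀ hμ hh₀ H₁ hu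
    have h2 := mul_lt_mul_of_pos_left hN hc
    rw [hJ]
    linarith
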